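/- Let $d\ge 1$ and let $\pi$ be a probability density on $\mathbb{R}^d$ that is everywhere positive and continuously differentiable, with super-exponentially decaying tails and regular contours, i.e. \[ \lim_{|x|\to\infty}\frac{x}{|x|}\cdot\nabla\log\pi(x)=-\infty \qquad\text{and}\qquad \limsup_{|x|\to\infty}\frac{x}{|x|}\cdot\frac{\nabla\pi(x)}{|\nabla\pi(x)|}<0 , \] where $|\cdot|$ is the Euclidean norm. Let $q$ be a symmetric probability density on $\mathbb{R}^d$ that is bounded away from zero in some neighbourhood of the origin. Let $\mathsf{W}\subseteq(0,\infty)$ be a Borel set and let $(Q_x)_{x\in\mathbb{R}^d}$ be a probability kernel from $\mathbb{R}^d$ to $\mathsf{W}$ with $\int w\,Q_x(\mathrm{d}w)=1$ for every $x$. Consider the pseudo-marginal random-walk Metropolis kernel on $\mathbb{R}^d\times\mathsf{W}$, \[ \tilde P(x,w;\mathrm{d}y,\mathrm{d}u)=\min\Big\{1,\frac{\pi(y)}{\pi(x)}\frac{u}{w}\Big\}\,q(y-x)\,\mathrm{d}y\,Q_y(\mathrm{d}u)+\tilde\rho(x,w)\,\delta_{(x,w)}(\mathrm{d}y,\mathrm{d}u),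 \] \[ \tilde\rho(x,w)=1-\iint\min\Big\{1,\frac{\pi(y)}{\pi(x)}\frac{u}{w}\Big\}\,q(y-x)\,\mathrm{d}y\,Q_y(\mathrm{d}u). \] Let $\alpha'>0$, $\beta'>1$ and $M_W<\infty$ be constants such that \[ \operatorname*{ess\,sup}_{x\in\mathbb{R}^d}\int (w^{-\alpha'}\vee w^{\beta'})\,Q_x(\mathrm{d}w)\le M_W , \] the essential supremum being with respect to Lebesgue measure. Let $\eta\in(0,\alpha'\wedge 1)$, $\alpha\in(\eta,\alpha']$, $\beta\in(0,\beta'-\eta)$, and define \[ V(x,w)=c_\pi^{\eta}\,\pi(x)^{-\eta}\,(w^{-\alpha}\vee w^{\beta}),\qquad c_\pi=\sup_{z\in\mathbb{R}^d}\pi(z). \] Then $V\ge 1$ on $\mathbb{R}^d\times\mathsf{W}$, and there exist constants $\bar w,M,b\in[1,\infty)$, $\underline w\in(0,1]$ and $\delta_V>0$ such that, with $\mathsf{C}=\{(x,w)\in\mathbb{R}^d\times\mathsf{W}: |x|\le M,\ w\in[\underline w,\bar w]\}$, the integral $\tilde PV(x,w)=\int V\,\mathrm{d}\tilde P(x,w;\cdot)$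 is finite for all $(x,w)$ and \[ \tilde PV(x,w)\le \begin{cases} V(x,w)-\delta_V\,V(x,w)^{\frac{\beta-1}{\beta}}, & (x,w)\notin\mathsf{C},\\ b, & (x,w)\in\mathsf{C}. \end{cases} \] Moreover, $\bar w,M,b,\underline w,\delta_V$ can be chosen depending only on $\pi$, $q$, $\alpha'$, $\beta'$, $M_W$, $\alpha$, $\beta$ and $\eta$ (and not otherwise on $\mathsf{W}$ or $(Q_x)$). -/

import Mathlib

open MeasureTheory ProbabilityTheory Filter Set
open scoped Topology ENNReal NNReal

noncomputable section

/-- A probability density `π` on `ℝ^d` which is everywhere positive, continuously differentiable,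
super-exponentially decaying and has regular contours. -/
structure IsSuperExpRegular {d : ℕ} (π : EuclideanSpace ℝ (Fin d) → ℝ) : Prop where
  pos : ∀ x, 0 < π x
  lintegral_eq_one : ∫⁻ x, ENNReal.ofReal (π x) = 1
  contDiff : ContDiff ℝ 1 π
  superExp : Tendsto
    (fun x => inner ℝ (‖x‖⁻¹ • x) (gradient (fun y => Real.log (π y)) x))
    (Bornology.cobounded (EuclideanSpace ℝ (Fin d))) atBot
  regularContours : limsup
    (fun x => inner ℝ (‖x‖⁻¹ • x) (‖gradient π x‖⁻¹ • gradient π x))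
    (Bornology.cobounded (EuclideanSpace ℝ (Fin d))) < 0

/-- A symmetric probability density `q` on `ℝ^d`, bounded away from zero in some neighbourhood of
the origin. -/
structure IsIncrementDensity {d : ℕ} (q : EuclideanSpace ℝ (Fin d) → ℝ) : Prop where
  measurable : Measurable q
  nonneg : ∀ z, 0 ≤ q z
  lintegral_eq_one : ∫⁻ z, ENNReal.ofReal (q z) = 1
  symmetric : ∀ z, q (-z) = q z
  bounded_below : ∃ ε > 0, ∀ᶠ z in 𝓝 (0 : EuclideanSpace ℝ (Fin d)), ε ≤ q z

/-- The random-walk proposal kernel `q(x, A) = ∫_A q(y - x) dy`. -/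
def rwProposal {d : ℕ} (q : EuclideanSpace ℝ (Fin d) → ℝ) :
    Kernel (EuclideanSpace ℝ (Fin d)) (EuclideanSpace ℝ (Fin d)) :=
  Kernel.withDensity (Kernel.const _ volume) (fun x y => ENNReal.ofReal (q (y - x)))

/-- The joint proposal `q(x, dy) Q_y(du)`, started from `(x, w)`. -/
def jointProposal {X : Type*} [MeasurableSpace X] {W : Set ℝ}
    (q : Kernel X X) (Q : Kernel X W) : Kernel (X × W) (X × W) :=
  (q ⊗ₖ Kernel.prodMkLeft X Q).comap Prod.fst measurable_fst

instance instIsSFiniteKernelJointProposal {X : Type*} [MeasurableSpace X] {W : Set ℝ} (q : Kernel X X) (Q : Kernel X W) :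
    IsSFiniteKernel (jointProposal q Q) := by
  unfold jointProposal
  infer_instance

/-- The acceptance probability `min {1, r(x, y) u / w}` of a move from `(x, w)` to `(y, u)`. -/
def acceptProb {X : Type*} {W : Set ℝ} (r : X → X → ℝ) (s t : X × W) : ℝ≥0∞ :=
  ENNReal.ofReal (min 1 (r s.1 t.1 * ((t.2 : ℝ) / (s.2 : ℝ))))

/-- The pseudo-marginal kernel
`min {1, r(x, y) u / w} q(x, dy) Q_y(du) + δ_{(x, w)}(dy, du) ρ(x, w)`, where `ρ(x, w)` is one minus
the total probability of acceptance, for the proposal kernel `q`, the marginal acceptance ratio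
`r` and the weight distributions `Q`. -/
def pseudoMarginalKernel {X : Type*} [MeasurableSpace X] {W : Set ℝ}
    (q : Kernel X X) (r : X → X → ℝ) (Q : Kernel X W) : Kernel (X × W) (X × W) :=
  Kernel.withDensity (jointProposal q Q) (acceptProb r) +
    Kernel.withDensity Kernel.id
      (fun s _ => 1 - ∫⁻ t, acceptProb r s t ∂(jointProposal q Q s))

/-- The pseudo-marginal kernel whose marginal algorithm is the random-walk Metropolis algorithm with
target density `π` and symmetric increment density `q`, so that `r(x, y) = π(y) / π(x)`. -/
def pseudoMarginalRWM {d : ℕ} {W : Set ℝ} (π q : EuclideanSpace ℝ (Fin d) → ℝ)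
    (Q : Kernel (EuclideanSpace ℝ (Fin d)) W) :
    Kernel (EuclideanSpace ℝ (Fin d) × W) (EuclideanSpace ℝ (Fin d) × W) :=
  pseudoMarginalKernel (rwProposal q) (fun x y => π y / π x) Q

/-- `ess sup_x ∫ (w^{-a} ∨ w^b) Q_x(dw)`, with respect to the Lebesgue measure. -/
def weightMoment {d : ℕ} {W : Set ℝ} (Q : Kernel (EuclideanSpace ℝ (Fin d)) W) (a b : ℝ) : ℝ≥0∞ :=
  essSup (fun x => ∫⁻ w, ENNReal.ofReal (max ((w : ℝ) ^ (-a)) ((w : ℝ) ^ b)) ∂(Q x)) volume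

/-- `V(x, w) = c_π^η π(x)^{-η} (w^{-α} ∨ w^β)` with `c_π = sup_z π(z)`. -/
def driftFun {d : ℕ} {W : Set ℝ} (π : EuclideanSpace ℝ (Fin d) → ℝ) (η α β : ℝ)
    (s : EuclideanSpace ℝ (Fin d) × W) : ℝ :=
  (⨆ z, π z) ^ η * (π s.1) ^ (-η) * max ((s.2 : ℝ) ^ (-α)) ((s.2 : ℝ) ^ β)

/-- `C = {(x, w) : |x| ≤ M, w ∈ [w₀, w₁]}`. -/
def driftSet (d : ℕ) (W : Set ℝ) (M w₀ w₁ : ℝ) : Set (EuclideanSpace ℝ (Fin d) × W) :=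
  {s | ‖s.1‖ ≤ M ∧ (s.2 : ℝ) ∈ Icc w₀ w₁}

end

/-! Write `a = π y / π x` and `H u = u ^ (-α') ∨ u ^ β'`. Since a rejected move leaves `V`
unchanged, the relative drift `P̃V / V - 1` is the mean of `driftIncrement`, that is, acceptance
probability times relative change of `V`. Each pointwise bound on it is affine in `H u` with
nonnegative slope. Averaging over `Q_y` then brings in only `MW`, so the constants do not depend on
`W` or `Q`.

Three regimes cover the complement of the set `C`. Small `w`: a proposal with `a ≥ κ` is accepted
with probability nearly at least `κ`, and `V` then drops by a large factor because `α > η`. The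
relative drift is at most a negative constant. Large `w`: acceptance is of order at least `1 / w`
when `a ≥ κ`, while the upward contributions not absorbed by acceptance are `o(1 / w)` because `β' >
1`. The relative drift is at most `-δ / w`, and `w ^ β ≤ V` turns this into `-δ V ^ ((β - 1) / β)`.
Moderate `w`, large `|x|`: the level sets of `π` are so tightly packed that `a` lies in `(1/K, K)`
with small probability. The event `a ≥ K` keeps a probability bounded below independently of `K` and
yields a definite decrease; for `a ≤ 1/K` the contribution is negligible.

The geometric input is `exists_log_add_le_log`; `integral_driftFun_le` joins it to the pointwise
bounds. -/

/-! ### Elementary inequalities for powers and truncated ratios. -/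

theorem Real.rpow_le_max_rpow {u e a b : ℝ} (hu : 0 < u) (ha : -a ≤ e) (hb : e ≤ b) :
    u ^ e ≤ max (u ^ (-a)) (u ^ b) := by
  rcases le_total u 1 with h | h
  · exact le_max_of_le_left (Real.rpow_le_rpow_of_exponent_ge hu h ha)
  · exact le_max_of_le_right (Real.rpow_le_rpow_of_exponent_le h hb)

theorem one_le_max_rpow {u a b : ℝ} (hu : 0 < u) (ha : 0 ≤ a) (hb : 0 ≤ b) :
    1 ≤ max (u ^ (-a)) (u ^ b) := by
  simpa using Real.rpow_le_max_rpow (e := 0) hu (by linarith) hb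

theorem rpow_mul_max_rpow_le {u g a b a' b' : ℝ} (hu : 0 < u) (h1 : -a' ≤ g - a)
    (h2 : g - a ≤ b') (h3 : -a' ≤ g + b) (h4 : g + b ≤ b') :
    u ^ g * max (u ^ (-a)) (u ^ b) ≤ max (u ^ (-a')) (u ^ b') := by
  rw [mul_max_of_nonneg _ _ (by positivity), ← Real.rpow_add hu, ← Real.rpow_add hu]
  exact max_le (Real.rpow_le_max_rpow hu (by linarith) (by linarith))
    (Real.rpow_le_max_rpow hu h3 h4)

theorem max_rpow_le_max_rpow {u a b a' b' : ℝ} (hu : 0 < u) (ha : 0 ≤ a) (hb : 0 ≤ b)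
    (haa : a ≤ a') (hbb : b ≤ b') :
    max (u ^ (-a)) (u ^ b) ≤ max (u ^ (-a')) (u ^ b') :=
  max_le (Real.rpow_le_max_rpow hu (by linarith) (by linarith))
    (Real.rpow_le_max_rpow hu (by linarith) hbb)

/-- A pointwise Markov inequality: if `u < v`, then `v ^ a * u ^ (-a) ≥ 1` makes the left side
nonpositive. It keeps lower bounds on acceptance affine in the weight moment. -/
theorem one_sub_rpow_mul_max_le_min {u v a b : ℝ} (hu : 0 < u) (hv : 0 < v) (ha : 0 ≤ a) :
    1 - v ^ a * max (u ^ (-a)) (u ^ b) ≤ min 1 (u / v) := by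
  have hH : 0 < max (u ^ (-a)) (u ^ b) := lt_max_of_lt_left (by positivity)
  rcases le_total v u with h | h
  · rw [min_eq_left ((one_le_div hv).2 h)]
    have : 0 < v ^ a * max (u ^ (-a)) (u ^ b) := by positivity
    linarith
  · have h1 : 1 ≤ v ^ a * max (u ^ (-a)) (u ^ b) := by
      calc (1 : ℝ) = v ^ a * v ^ (-a) := by rw [← Real.rpow_add hv]; simp
        _ ≤ v ^ a * u ^ (-a) := by
            gcongr ?_ * ?_
            exact Real.rpow_le_rpow_of_nonpos hu h (by linarith)
        _ ≤ _ := by gcongr; exact le_max_left _ _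
    have : 0 < min 1 (u / v) := lt_min one_pos (by positivity)
    linarith

theorem min_one_le_rpow {r g : ℝ} (hr : 0 < r) (h0 : 0 ≤ g) (h1 : g ≤ 1) : min 1 r ≤ r ^ g := by
  rcases le_total r 1 with h | h
  · rw [min_eq_right h]
    simpa using Real.rpow_le_rpow_of_exponent_ge hr h h1
  · rw [min_eq_left h]; exact Real.one_le_rpow h h0

theorem min_one_mul_rpow_le {r a g η : ℝ} {t : ℝ} (ha : 0 < a) (ht : 0 < t) (hr : r = a * t)
    (h0 : 0 ≤ g) (h1 : g ≤ 1) : min 1 r * a ^ (-η) ≤ a ^ (g - η) * t ^ g := by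
  calc min 1 r * a ^ (-η) ≤ (a * t) ^ g * a ^ (-η) := by
        gcongr; rw [hr]; exact min_one_le_rpow (by positivity) h0 h1
    _ = _ := by
        rw [Real.mul_rpow ha.le ht.le, sub_eq_add_neg, Real.rpow_add ha]; ring

/-- The relative change of the drift function under a proposed move, weighted by its acceptance
probability; `a` is the ratio of the target densities. -/
noncomputable def driftIncrement (η α β w a u : ℝ) : ℝ :=
  min 1 (a * (u / w)) *
    (a ^ (-η) * max (u ^ (-α)) (u ^ β) / max (w ^ (-α)) (w ^ β) - 1)

/-! ### Pointwise bounds on the drift increment. -/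

section
variable {η α β α' β' w a u : ℝ}

/-- Acceptance is at most the `g`-th power of its ratio. The free exponent serves three ends: `g =
η` removes `a`, `g > η` gives smallness as `a → 0`, and `g + β > 1` gives decay faster than `1 / w`.
-/
theorem min_mul_rpow_mul_max_le {g : ℝ} (ha : 0 < a) (hu : 0 < u) (hw : 0 < w)
    (h0 : 0 ≤ g) (h1 : g ≤ 1) (hβ : 0 ≤ β) (hα : 0 ≤ α) (hα' : α ≤ α') (hβ' : g + β ≤ β') :
    min 1 (a * (u / w)) * (a ^ (-η) * max (u ^ (-α)) (u ^ β) / max (w ^ (-α)) (w ^ β)) ≤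
      a ^ (g - η) * w ^ (-g) / max (w ^ (-α)) (w ^ β) * max (u ^ (-α')) (u ^ β') := by
  have hφw : 0 < max (w ^ (-α)) (w ^ β) := lt_max_of_lt_left (by positivity)
  have hφu : 0 < max (u ^ (-α)) (u ^ β) := lt_max_of_lt_left (by positivity)
  have h := rpow_mul_max_rpow_le (g := g) (a := α) (b := β) (a' := α') (b' := β') hu
    (by linarith) (by linarith) (by linarith) (by linarith)
  calc _ = (min 1 (a * (u / w)) * a ^ (-η)) * max (u ^ (-α)) (u ^ β) / max (w ^ (-α)) (w ^ β) := by
        ring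
    _ ≤ (a ^ (g - η) * (u / w) ^ g) * max (u ^ (-α)) (u ^ β) / max (w ^ (-α)) (w ^ β) := by
        refine div_le_div_of_nonneg_right (mul_le_mul_of_nonneg_right ?_ hφu.le) hφw.le
        exact min_one_mul_rpow_le ha (by positivity) rfl h0 h1
    _ = a ^ (g - η) * w ^ (-g) / max (w ^ (-α)) (w ^ β) * (u ^ g * max (u ^ (-α)) (u ^ β)) := by
        rw [Real.div_rpow hu.le hw.le, Real.rpow_neg hw.le g]; ring
    _ ≤ _ := by gcongr

theorem driftIncrement_le {g : ℝ} (ha : 0 < a) (hu : 0 < u) (hw : 0 < w)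
    (h0 : 0 ≤ g) (h1 : g ≤ 1) (hβ : 0 ≤ β) (hα : 0 ≤ α) (hα' : α ≤ α') (hβ' : g + β ≤ β') :
    driftIncrement η α β w a u ≤
      a ^ (g - η) * w ^ (-g) / max (w ^ (-α)) (w ^ β) * max (u ^ (-α')) (u ^ β') := by
  have h := min_mul_rpow_mul_max_le (η := η) ha hu hw h0 h1 hβ hα hα' hβ'
  have : 0 < min 1 (a * (u / w)) := lt_min one_pos (by positivity)
  unfold driftIncrement
  linarith

theorem driftIncrement_le_of_ratio_ge {κ : ℝ} (hκ : 0 < κ) (hκ1 : κ ≤ 1) (ha : κ ≤ a) (hu : 0 < u)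
    (hw : 0 < w) (hη : 0 ≤ η) (h1 : η ≤ 1) (hβ : 0 ≤ β) (hα : 0 ≤ α) (hα' : α ≤ α')
    (hβ' : η + β ≤ β') :
    driftIncrement η α β w a u ≤
      -κ + (κ * w ^ α' + w ^ (-η) / max (w ^ (-α)) (w ^ β)) * max (u ^ (-α')) (u ^ β') := by
  have ha0 : 0 < a := hκ.trans_le ha
  have h := min_mul_rpow_mul_max_le (η := η) ha0 hu hw hη h1 hβ hα hα' hβ'
  have h2 := one_sub_rpow_mul_max_le_min (a := α') (b := β') hu hw (by linarith)
  have h3 : κ * min 1 (u / w) ≤ min 1 (a * (u / w)) := by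
    refine le_min ?_ ?_
    · exact mul_le_one₀ hκ1 (le_min zero_le_one (by positivity)) (min_le_left _ _)
    · exact mul_le_mul ha (min_le_right _ _) (le_min zero_le_one (by positivity)) ha0.le
  simp only [sub_self, Real.rpow_zero, one_mul] at h
  unfold driftIncrement
  nlinarith [mul_le_mul_of_nonneg_left h2 hκ.le]

theorem driftIncrement_le_of_ratio_large {K w₁ : ℝ} (hK : 0 < K) (ha : K ≤ a) (hu : 0 < u)
    (hw : 0 < w) (hw₁ : w ≤ w₁) (hη : 0 ≤ η) (hβ : 0 ≤ β) (hα : 0 ≤ α) (hα' : α ≤ α')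
    (hβ' : β ≤ β') :
    driftIncrement η α β w a u ≤
      -1 + ((w₁ / K) ^ α' + K ^ (-η)) * max (u ^ (-α')) (u ^ β') := by
  have ha0 : 0 < a := hK.trans_le ha
  have hφw : 1 ≤ max (w ^ (-α)) (w ^ β) := one_le_max_rpow hw hα hβ
  have hφu : 0 < max (u ^ (-α)) (u ^ β) := lt_max_of_lt_left (by positivity)
  have hw₁0 : 0 < w₁ := hw.trans_le hw₁
  have h2 := one_sub_rpow_mul_max_le_min (v := w₁ / K) (a := α') (b := β') hu (by positivity)
    (by linarith)
  have h3 : min 1 (u / (w₁ / K)) ≤ min 1 (a * (u / w)) := by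
    refine min_le_min_left _ ?_
    calc u / (w₁ / K) = K * (u / w₁) := by field_simp
      _ ≤ _ := by gcongr
  have h4 : min 1 (a * (u / w)) *
      (a ^ (-η) * max (u ^ (-α)) (u ^ β) / max (w ^ (-α)) (w ^ β)) ≤
      K ^ (-η) * max (u ^ (-α')) (u ^ β') := by
    have h5 : max (u ^ (-α)) (u ^ β) ≤ max (u ^ (-α')) (u ^ β') :=
        max_rpow_le_max_rpow hu hα hβ hα' hβ'
    calc _ ≤ 1 * (a ^ (-η) * max (u ^ (-α)) (u ^ β) / max (w ^ (-α)) (w ^ β)) := by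
          gcongr; exact min_le_left _ _
      _ ≤ a ^ (-η) * max (u ^ (-α)) (u ^ β) := by
          rw [one_mul]; exact div_le_self (by positivity) hφw
      _ ≤ _ := by
          gcongr ?_ * ?_
          exact Real.rpow_le_rpow_of_nonpos hK ha (by linarith)
  unfold driftIncrement
  linarith

/-- Below a threshold the left side is at most `1 / 2`; above it, `t ^ β'` dominates `t ^ β`. The `1
/ 2` lets half of the acceptance probability absorb upward moves. -/
theorem exists_mul_rpow_le_half_add {k : ℝ} (hk : 0 < k) (hβ : 0 < β) (h : β ≤ β') :
    ∃ C, 0 < C ∧ ∀ t, 0 < t → k * t ^ β ≤ 1 / 2 + C * t ^ β' := by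
  set t₀ : ℝ := (1 / (2 * k)) ^ (1 / β) with ht₀
  have ht₀0 : 0 < t₀ := by positivity
  refine ⟨k * t₀ ^ (β - β'), by positivity, fun t ht => ?_⟩
  rcases le_total t t₀ with h1 | h1
  · have : t ^ β ≤ 1 / (2 * k) := by
      calc t ^ β ≤ t₀ ^ β := by gcongr
        _ = _ := by rw [ht₀, ← Real.rpow_mul (by positivity), one_div_mul_cancel hβ.ne', Real.rpow_one]
    have h3 : k * t ^ β ≤ 1 / 2 := by
      calc k * t ^ β ≤ k * (1 / (2 * k)) := by gcongr
        _ = 1 / 2 := by field_simp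
    have : 0 < k * t₀ ^ (β - β') * t ^ β' := by positivity
    linarith
  · have : t ^ β = t ^ (β - β') * t ^ β' := by rw [← Real.rpow_add ht]; simp
    have h2 : t ^ (β - β') ≤ t₀ ^ (β - β') :=
      Real.rpow_le_rpow_of_nonpos ht₀0 h1 (by linarith)
    rw [this, ← mul_assoc]
    have : k * t ^ (β - β') * t ^ β' ≤ k * t₀ ^ (β - β') * t ^ β' := by gcongr
    linarith

/-- For `u ≤ 1` acceptance is at most `m = min 1 (a / w)`, so the growth term is proportional to
`m`. For `u ≥ 1` growth costs half the acceptance plus `C * w ^ (-β') * H`. The remaining half is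
bounded below through the event `u ≥ ε`. Keeping the factor `m` makes the estimate usable for
arbitrarily large `a`. -/
theorem driftIncrement_le_of_weight_large {κ ε C : ℝ} (hκ : 0 < κ) (ha : κ ≤ a)
    (hu : 0 < u) (hw : 1 ≤ w) (hη : 0 ≤ η) (hβ : 0 ≤ β) (hα : 0 ≤ α) (hα' : α ≤ α')
    (hβ' : β ≤ β') (hε : 0 < ε) (hε1 : ε ≤ 1) (hC : 0 ≤ C)
    (hCt : ∀ t, 0 < t → κ ^ (-η) * t ^ β ≤ 1 / 2 + C * t ^ β') :
    driftIncrement η α β w a u ≤ -(min 1 (a / w) * ε / 2) +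
      (min 1 (a / w) * (ε * ε ^ α' / 2 + κ ^ (-η) * w ^ (-β)) + C * w ^ (-β')) *
        max (u ^ (-α')) (u ^ β') := by
  have ha0 : 0 < a := hκ.trans_le ha
  have hw0 : 0 < w := by linarith
  have hH : 0 < max (u ^ (-α')) (u ^ β') := lt_max_of_lt_left (by positivity)
  set H := max (u ^ (-α')) (u ^ β') with hHdef
  set m := min 1 (a / w) with hm
  set A := min 1 (a * (u / w)) with hA
  have hm0 : 0 < m := lt_min one_pos (by positivity)
  have hA0 : 0 < A := lt_min one_pos (by positivity)
  have hφw : max (w ^ (-α)) (w ^ β) = w ^ β :=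
    max_eq_right (Real.rpow_le_rpow_of_exponent_le hw (by linarith))
  have hlow : m * (ε * (1 - ε ^ α' * H)) ≤ A := by
    have h2 := one_sub_rpow_mul_max_le_min (a := α') (b := β') hu hε (by linarith)
    have h3 : ε * min 1 (u / ε) ≤ min 1 u := by
      refine le_min ?_ ?_
      · exact mul_le_one₀ hε1 (le_min zero_le_one (by positivity)) (min_le_left _ _)
      · calc _ ≤ ε * (u / ε) := by gcongr; exact min_le_right _ _
          _ = u := by field_simp
    have h4 : m * min 1 u ≤ A := by
      refine le_min ?_ ?_
      · exact mul_le_one₀ (min_le_left _ _) (le_min zero_le_one hu.le) (min_le_left _ _)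
      · calc _ ≤ (a / w) * u :=
              mul_le_mul (min_le_right _ _) (min_le_right _ _) (le_min zero_le_one hu.le)
                (by positivity)
          _ = _ := by ring
    calc m * (ε * (1 - ε ^ α' * H)) ≤ m * (ε * min 1 (u / ε)) := by gcongr
      _ ≤ m * min 1 u := by gcongr
      _ ≤ A := h4
  have haκ : a ^ (-η) ≤ κ ^ (-η) := Real.rpow_le_rpow_of_nonpos hκ ha (by linarith)
  have hup : A * (a ^ (-η) * max (u ^ (-α)) (u ^ β) / w ^ β) ≤
      A / 2 + (m * (κ ^ (-η) * w ^ (-β)) + C * w ^ (-β')) * H := by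
    rcases le_total u 1 with h | h
    · have h1 : A ≤ m := by
        refine min_le_min_left _ ?_
        rw [mul_div_assoc']
        gcongr
        exact mul_le_of_le_one_right ha0.le h
      have h5 : max (u ^ (-α)) (u ^ β) ≤ H :=
        max_rpow_le_max_rpow hu hα hβ hα' hβ'
      have h6 : 0 ≤ max (u ^ (-α)) (u ^ β) := le_max_of_le_left (by positivity)
      calc _ ≤ m * (κ ^ (-η) * H / w ^ β) := by gcongr
        _ = m * (κ ^ (-η) * w ^ (-β)) * H := by rw [Real.rpow_neg hw0.le]; ring
        _ ≤ _ := by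
            have : 0 ≤ C * w ^ (-β') * H := by positivity
            nlinarith
    · rw [max_eq_right (Real.rpow_le_rpow_of_exponent_le h (by linarith : -α ≤ β))]
      have h7 := hCt (u / w) (by positivity)
      have h8 : u ^ β' ≤ H := le_max_right _ _
      have hA1 : A ≤ 1 := min_le_left _ _
      calc A * (a ^ (-η) * u ^ β / w ^ β) ≤ A * (κ ^ (-η) * u ^ β / w ^ β) := by gcongr
        _ = A * (κ ^ (-η) * (u / w) ^ β) := by rw [Real.div_rpow hu.le hw0.le]; ring
        _ ≤ A * (1 / 2 + C * (u / w) ^ β') := by gcongr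
        _ ≤ A / 2 + 1 * (C * (u / w) ^ β') := by
            have : A * (C * (u / w) ^ β') ≤ 1 * (C * (u / w) ^ β') := by gcongr
            linarith
        _ = A / 2 + C * w ^ (-β') * u ^ β' := by
            rw [Real.div_rpow hu.le hw0.le, Real.rpow_neg hw0.le]; ring
        _ ≤ A / 2 + C * w ^ (-β') * H := by gcongr
        _ ≤ _ := by
            have : 0 ≤ m * (κ ^ (-η) * w ^ (-β)) * H := by positivity
            nlinarith
  unfold driftIncrement
  rw [hφw, ← hA]
  nlinarith

/-! ### Bounds averaged over the proposed weight, by size of the current weight. -/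

/-- The drift increment is bounded by a function of the proposed weight whose mean is at most `k`
whenever the mean of `u ^ (-α') ∨ u ^ β'` is at most `m`. -/
def DriftIncrementBound (η α β α' β' m w a k : ℝ) : Prop :=
  ∃ c₁ c₂ : ℝ, 0 ≤ c₂ ∧ c₁ + c₂ * m ≤ k ∧
    ∀ u : ℝ, 0 < u → driftIncrement η α β w a u ≤ c₁ + c₂ * max (u ^ (-α')) (u ^ β')

theorem DriftIncrementBound.mono {m k k' : ℝ} (h : DriftIncrementBound η α β α' β' m w a k)
    (hk : k ≤ k') : DriftIncrementBound η α β α' β' m w a k' := by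
  obtain ⟨c₁, c₂, h0, h1, h2⟩ := h
  exact ⟨c₁, c₂, h0, h1.trans hk, h2⟩

theorem driftIncrementBound_rpow {g m : ℝ} (ha : 0 < a) (hw : 0 < w) (h0 : 0 ≤ g) (h1 : g ≤ 1)
    (hβ : 0 ≤ β) (hα : 0 ≤ α) (hα' : α ≤ α') (hβ' : g + β ≤ β') :
    DriftIncrementBound η α β α' β' m w a
      (a ^ (g - η) * w ^ (-g) / max (w ^ (-α)) (w ^ β) * m) := by
  have hφ : 0 < max (w ^ (-α)) (w ^ β) := lt_max_of_lt_left (by positivity)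
  refine ⟨0, a ^ (g - η) * w ^ (-g) / max (w ^ (-α)) (w ^ β), by positivity, by simp,
    fun u hu => ?_⟩
  rw [zero_add]
  exact driftIncrement_le ha hu hw h0 h1 hβ hα hα' hβ'

theorem driftIncrementBound_of_le_weight {w₀ m : ℝ} (ha : 0 < a) (hw₀ : 0 < w₀) (hw : w₀ ≤ w)
    (hm : 0 ≤ m) (hη : 0 ≤ η) (h1 : η ≤ 1) (hβ : 0 ≤ β) (hα : 0 ≤ α) (hα' : α ≤ α')
    (hβ' : η + β ≤ β') :
    DriftIncrementBound η α β α' β' m w a (w₀ ^ (-η) * m) := by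
  have hw0 : 0 < w := hw₀.trans_le hw
  refine (driftIncrementBound_rpow ha hw0 hη h1 hβ hα hα' hβ').mono ?_
  rw [sub_self, Real.rpow_zero, one_mul]
  have h3 : w ^ (-η) ≤ w₀ ^ (-η) := Real.rpow_le_rpow_of_nonpos hw₀ hw (by linarith)
  have h4 : w ^ (-η) / max (w ^ (-α)) (w ^ β) ≤ w ^ (-η) :=
    div_le_self (by positivity) (one_le_max_rpow hw0 hα hβ)
  exact mul_le_mul_of_nonneg_right (h4.trans h3) hm

/-- Drift for small weights. -/
theorem exists_driftIncrementBound_of_weight_le {κ e m : ℝ} (hκ : 0 < κ) (hκ1 : κ ≤ 1)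
    (he : 0 < e) (hm : 0 ≤ m) (hη : 0 ≤ η) (h1 : η ≤ 1) (hβ : 0 ≤ β) (hα : η < α)
    (hα' : α ≤ α') (hβ' : η + β ≤ β') :
    ∃ w₀ > 0, w₀ ≤ 1 ∧ ∀ w, 0 < w → w ≤ w₀ →
      (∀ a, 0 < a → DriftIncrementBound η α β α' β' m w a e) ∧
      (∀ a, κ ≤ a → DriftIncrementBound η α β α' β' m w a (e - κ / 2)) := by
  have t1 : Tendsto (fun w : ℝ => w ^ (α - η) * m) (𝓝 0) (𝓝 0) := by
    have := (Real.continuousAt_rpow_const 0 (α - η) (Or.inr (by linarith))).tendsto.mul_const m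
    rwa [Real.zero_rpow (by linarith), zero_mul] at this
  have t2 : Tendsto (fun w : ℝ => w ^ α' * m) (𝓝 0) (𝓝 0) := by
    have := (Real.continuousAt_rpow_const 0 α' (Or.inr (by linarith))).tendsto.mul_const m
    rwa [Real.zero_rpow (by linarith), zero_mul] at this
  obtain ⟨r, hr, H⟩ := Metric.eventually_nhds_iff.1
    ((t1.eventually (gt_mem_nhds he)).and (t2.eventually (gt_mem_nhds (half_pos one_pos))))
  refine ⟨min 1 (r / 2), by positivity, min_le_left _ _, fun w hw hwr => ?_⟩
  have hwr' : w < r := by have := hwr.trans (min_le_right _ _); linarith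
  obtain ⟨h2, h3⟩ := H (y := w) (by simpa [abs_of_pos hw] using hwr')
  have hφ : 0 < max (w ^ (-α)) (w ^ β) := lt_max_of_lt_left (by positivity)
  -- Here `α > η` is what makes the growth term vanish as `w → 0`.
  have h4 : w ^ (-η) / max (w ^ (-α)) (w ^ β) ≤ w ^ (α - η) := by
    rw [div_le_iff₀ hφ]
    calc w ^ (-η) = w ^ (α - η) * w ^ (-α) := by rw [← Real.rpow_add hw]; congr 1; ring
      _ ≤ _ := by gcongr; exact le_max_left _ _
  have h5 : w ^ (-η) / max (w ^ (-α)) (w ^ β) * m ≤ e := le_trans (by gcongr) h2.le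
  refine ⟨fun a ha => (driftIncrementBound_rpow ha hw hη h1 hβ (by linarith) hα' hβ').mono ?_,
    fun a ha => ⟨-κ, κ * w ^ α' + w ^ (-η) / max (w ^ (-α)) (w ^ β), by positivity, ?_, fun u hu =>
      driftIncrement_le_of_ratio_ge hκ hκ1 ha hu hw hη h1 hβ (by linarith) hα' hβ'⟩⟩
  · simpa using h5
  · nlinarith

/-- Drift for large weights. -/
theorem exists_driftIncrementBound_of_le_weight {κ m p : ℝ} (hκ : 0 < κ) (hκ1 : κ ≤ 1)
    (hm : 0 ≤ m) (hp : 0 < p) (hη : 0 ≤ η) (h1 : η ≤ 1) (hβ : 0 < β) (hα : 0 ≤ α)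
    (hα' : α ≤ α') (hα'0 : 0 < α') (hβ' : η + β ≤ β') (hβ'1 : 1 < β') :
    ∃ w₁ ≥ 1, ∃ δ > 0, ∀ w, w₁ ≤ w → ∃ e c, 0 ≤ c ∧ e - c * p ≤ -(δ / w) ∧
      (∀ a, 0 < a → DriftIncrementBound η α β α' β' m w a e) ∧
      (∀ a, κ ≤ a → DriftIncrementBound η α β α' β' m w a (e - c)) := by
  obtain ⟨ε, hε, hε1, hεm⟩ : ∃ ε > 0, ε ≤ 1 ∧ ε ^ α' * m ≤ 1 / 2 := by
    have t2 : Tendsto (fun w : ℝ => w ^ α' * m) (𝓝[>] 0) (𝓝 0) := by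
      have := (Real.continuousAt_rpow_const 0 α' (Or.inr hα'0.le)).tendsto.mul_const m
      rw [Real.zero_rpow hα'0.ne', zero_mul] at this
      exact this.mono_left nhdsWithin_le_nhds
    obtain ⟨ε, h1, h2⟩ := ((t2.eventually (gt_mem_nhds (half_pos one_pos))).and
      (Ioc_mem_nhdsGT one_pos)).exists
    exact ⟨ε, h2.1, h2.2, h1.le⟩
  obtain ⟨C, hC, hCt⟩ := exists_mul_rpow_le_half_add (k := κ ^ (-η)) (by positivity) hβ
    (by linarith : β ≤ β')
  -- The largest exponent compatible with `g ≤ 1` and `g + β ≤ β'`. It satisfies `g ≥ η` and `g + β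
  -- > 1`, so `w ^ (-(g + β))` is `o(1 / w)`.
  set g := min 1 (β' - β) with hg
  have hg1 : g ≤ 1 := min_le_left _ _
  have hgη : η ≤ g := le_min h1 (by linarith)
  have hgβ : g + β ≤ β' := by linarith [min_le_right 1 (β' - β)]
  have hgβ1 : 1 < g + β := by
    rcases min_choice 1 (β' - β) with h | h <;> rw [hg, h] <;> linarith
  have t1 : Tendsto (fun w : ℝ => κ ^ (-η) * w ^ (-β) * m) atTop (𝓝 0) := by
    simpa using ((tendsto_rpow_neg_atTop hβ).const_mul (κ ^ (-η))).mul_const m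
  have t2 : Tendsto (fun w : ℝ => w ^ (-(g + β - 1)) * m + C * w ^ (-(β' - 1)) * m) atTop
      (𝓝 0) := by
    simpa using ((tendsto_rpow_neg_atTop (by linarith : 0 < g + β - 1)).mul_const m).add
      (((tendsto_rpow_neg_atTop (by linarith : 0 < β' - 1)).const_mul C).mul_const m)
  obtain ⟨w₁, hw₁⟩ := eventually_atTop.1
    ((t1.eventually (gt_mem_nhds (by positivity : 0 < ε / 8))).and
      (t2.eventually (gt_mem_nhds (by positivity : 0 < p * κ * ε / 16))))
  -- The gain from `a ≥ κ` is worth `p * κ * ε / (8 * w)`; the errors use up at most half of it.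
  refine ⟨max 1 w₁, le_max_left _ _, p * κ * ε / 16, by positivity, fun w hw => ?_⟩
  have hw1 : 1 ≤ w := (le_max_left _ _).trans hw
  have hw0 : 0 < w := by linarith
  obtain ⟨h2, h3⟩ := hw₁ w ((le_max_right _ _).trans hw)
  have hφ : max (w ^ (-α)) (w ^ β) = w ^ β :=
    max_eq_right (Real.rpow_le_rpow_of_exponent_le hw1 (by linarith))
  have r1 : w ^ (-(g + β - 1)) = w * w ^ (-(g + β)) := by
    rw [neg_sub, sub_eq_add_neg, Real.rpow_add hw0, Real.rpow_one]
  have r2 : w ^ (-(β' - 1)) = w * w ^ (-β') := by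
    rw [neg_sub, sub_eq_add_neg, Real.rpow_add hw0, Real.rpow_one]
  have r3 : w ^ (-(g + β)) = w ^ (-g) / w ^ β := by
    rw [neg_add, Real.rpow_add hw0, Real.rpow_neg hw0.le β, div_eq_mul_inv]
  -- Of the gain `k * ε / 2`, the `ε ^ α'` term costs at most `k * ε / 4` and the `w ^ (-β)` term at
  -- most `k * ε / 8`. What is left is at least `κ * ε / (8 * w)`, as `k ≥ κ / w`.
  have hlarge : ∀ a, κ ≤ a → DriftIncrementBound η α β α' β' m w a
      (w ^ (-(g + β)) * m + C * w ^ (-β') * m - κ * ε / (8 * w)) := by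
    intro a ha
    have ha0 : 0 < a := hκ.trans_le ha
    refine ⟨-(min 1 (a / w) * ε / 2),
      min 1 (a / w) * (ε * ε ^ α' / 2 + κ ^ (-η) * w ^ (-β)) + C * w ^ (-β'), ?_, ?_, fun u hu =>
      driftIncrement_le_of_weight_large hκ ha hu hw1 hη hβ.le hα hα' (by linarith) hε hε1 hC.le
        hCt⟩
    · positivity
    · have hmin : κ / w ≤ min 1 (a / w) :=
        le_min ((div_le_one hw0).2 (hκ1.trans hw1)) (by gcongr)
      set k := min 1 (a / w)
      have hk : 0 < k := lt_of_lt_of_le (by positivity) hmin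
      have h4 : 0 ≤ w ^ (-(g + β)) * m := by positivity
      have h5 : κ * ε / (8 * w) = κ / w * (ε / 8) := by field_simp
      have h6 : κ / w * (ε / 8) ≤ k * (ε / 8) := by gcongr
      have h7 : k * (ε * (ε ^ α' * m) / 2) ≤ k * (ε * (1 / 2) / 2) := by gcongr
      have h8 : k * (κ ^ (-η) * w ^ (-β) * m) ≤ k * (ε / 8) := by gcongr
      rw [h5]
      linarith
  refine ⟨w ^ (-(g + β)) * m + C * w ^ (-β') * m, κ * ε / (8 * w), by positivity, ?_, ?_, hlarge⟩
  · have h4 : w ^ (-(g + β)) * m + C * w ^ (-β') * m ≤ p * κ * ε / 16 / w := by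
      rw [le_div_iff₀ hw0]
      rw [r1, r2] at h3
      linarith
    have h5 : κ * ε / (8 * w) * p = 2 * (p * κ * ε / 16 / w) := by field_simp; norm_num
    linarith
  · intro a ha
    have hpos : 0 ≤ C * w ^ (-β') * m := by positivity
    -- For `a ≤ 1` the factor `a ^ (g - η)` is harmless; for `a ≥ 1 ≥ κ` the previous bound applies
    -- with its gain discarded.
    rcases le_total a 1 with ha1 | ha1
    · refine (driftIncrementBound_rpow ha hw0 (hη.trans hgη) hg1 hβ.le hα hα' hgβ).mono ?_
      rw [hφ, mul_div_assoc, ← r3]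
      have : a ^ (g - η) ≤ 1 := Real.rpow_le_one ha.le ha1 (by linarith)
      have h6 : a ^ (g - η) * w ^ (-(g + β)) * m ≤ 1 * w ^ (-(g + β)) * m := by gcongr
      linarith
    · refine (hlarge a (hκ1.trans ha1)).mono ?_
      have : 0 ≤ κ * ε / (8 * w) := by positivity
      linarith

/-- Drift for weights in a compact interval, when the density ratio is very large or very small. -/
theorem exists_driftIncrementBound_of_weight_mem_Icc {w₀ w₁ m e : ℝ} (hw₀ : 0 < w₀)
    (hm : 0 ≤ m) (he : 0 < e) (hη : 0 < η) (h1 : η < 1) (hβ : 0 < β)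
    (hα : 0 ≤ α) (hα' : α ≤ α') (hα'0 : 0 < α') (hβ' : η + β < β') :
    ∃ K > 1, ∀ w ∈ Icc w₀ w₁,
      (∀ a, 0 < a → a ≤ K⁻¹ → DriftIncrementBound η α β α' β' m w a e) ∧
      (∀ a, K ≤ a → DriftIncrementBound η α β α' β' m w a (e - 1 / 2)) := by
  -- Now `g > η` strictly, so `a ^ (g - η)` is small for `a ≤ K⁻¹`.
  set g := min 1 (β' - β) with hg
  have hg1 : g ≤ 1 := min_le_left _ _
  have hgη : η < g := lt_min h1 (by linarith)
  have hgβ : g + β ≤ β' := by linarith [min_le_right 1 (β' - β)]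
  have t1 : Tendsto (fun K : ℝ => K ^ (-(g - η)) * w₀ ^ (-g) * m) atTop (𝓝 0) := by
    simpa using ((tendsto_rpow_neg_atTop (by linarith : 0 < g - η)).mul_const (w₀ ^ (-g))).mul_const
      m
  have t2 : Tendsto (fun K : ℝ => ((w₁ / K) ^ α' + K ^ (-η)) * m) atTop (𝓝 0) := by
    have h2 : Tendsto (fun K : ℝ => w₁ / K) atTop (𝓝 0) := tendsto_id.const_div_atTop w₁
    have h3 := h2.rpow_const (p := α') (Or.inr hα'0.le)
    rw [Real.zero_rpow hα'0.ne'] at h3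
    simpa using (h3.add (tendsto_rpow_neg_atTop hη)).mul_const m
  obtain ⟨K, ⟨hK1, hK2⟩, hK⟩ := (((t1.eventually (gt_mem_nhds he)).and
    (t2.eventually (gt_mem_nhds (half_pos one_pos)))).and (eventually_gt_atTop 1)).exists
  have hK0 : 0 < K := by linarith
  refine ⟨K, hK, fun w hw => ⟨fun a ha haK => ?_, fun a ha => ?_⟩⟩
  · have hw0 : 0 < w := hw₀.trans_le hw.1
    refine (driftIncrementBound_rpow ha hw0 (hη.trans hgη).le hg1 hβ.le hα hα' hgβ).mono ?_
    refine le_trans ?_ hK1.le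
    have h2 : a ^ (g - η) ≤ K ^ (-(g - η)) := by
      rw [Real.rpow_neg hK0.le, ← Real.inv_rpow hK0.le]
      exact Real.rpow_le_rpow ha.le haK (by linarith)
    have h3 : w ^ (-g) ≤ w₀ ^ (-g) := Real.rpow_le_rpow_of_nonpos hw₀ hw.1 (by linarith)
    have h4 : a ^ (g - η) * w ^ (-g) / max (w ^ (-α)) (w ^ β) ≤ a ^ (g - η) * w ^ (-g) :=
      div_le_self (by positivity) (one_le_max_rpow hw0 hα hβ.le)
    have h5 : a ^ (g - η) * w ^ (-g) ≤ K ^ (-(g - η)) * w₀ ^ (-g) := by gcongr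
    exact mul_le_mul_of_nonneg_right (h4.trans h5) hm
  · have hw0 : 0 < w := hw₀.trans_le hw.1
    have hw₁ : 0 < w₁ := hw0.trans_le hw.2
    refine ⟨-1, (w₁ / K) ^ α' + K ^ (-η), by positivity, ?_, fun u hu =>
      driftIncrement_le_of_ratio_large hK0 ha hu hw0 hw.2 hη.le hβ.le hα hα' (by linarith)⟩
    linarith

end

/-! ### Geometry of the target in the tails. -/

theorem norm_inv_smul_sub_inv_smul_le {E : Type*} [NormedAddCommGroup E] [NormedSpace ℝ E]
    {x y : E} (hx : x ≠ 0) (hy : y ≠ 0) :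
    ‖‖x‖⁻¹ • x - ‖y‖⁻¹ • y‖ ≤ 2 * ‖y - x‖ / ‖x‖ := by
  have hx' : 0 < ‖x‖ := norm_pos_iff.2 hx
  have hy' : 0 < ‖y‖ := norm_pos_iff.2 hy
  have h : ‖x‖⁻¹ • x - ‖y‖⁻¹ • y = ‖x‖⁻¹ • (x - y) + (‖x‖⁻¹ * (‖y‖ - ‖x‖) * ‖y‖⁻¹) • y := by
    have : ‖x‖⁻¹ * (‖y‖ - ‖x‖) * ‖y‖⁻¹ = ‖x‖⁻¹ - ‖y‖⁻¹ := by field_simp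
    rw [this]; module
  rw [h]
  refine (norm_add_le _ _).trans ?_
  rw [norm_smul, norm_smul, norm_mul, norm_mul, norm_inv, norm_inv, norm_norm, norm_norm,
    Real.norm_eq_abs, mul_assoc _ _ ‖y‖, inv_mul_cancel₀ hy'.ne', mul_one, norm_sub_rev x y]
  have := abs_norm_sub_norm_le y x
  calc _ ≤ ‖x‖⁻¹ * ‖y - x‖ + ‖x‖⁻¹ * ‖y - x‖ := by gcongr
    _ = _ := by ring

/-- If `N` translates of `S` are pairwise disjoint and contained in `B`, then `N μ(S) ≤ μ(B)`. -/
theorem nsmul_measure_le_of_disjoint_translates {E : Type*} [AddGroup E] [MeasurableSpace E]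
    [MeasurableAdd E] (μ : Measure E) [μ.IsAddRightInvariant] {S B : Set E}
    (hS : MeasurableSet S) (v : ℕ → E) (N : ℕ)
    (hd : ∀ i < N, ∀ j < N, i < j → ∀ y ∈ S, ∀ z ∈ S, y + v i ≠ z + v j)
    (hB : ∀ y ∈ S, ∀ j < N, y + v j ∈ B) : N * μ S ≤ μ B := by
  have hm : ∀ j ∈ Finset.range N, MeasurableSet ((fun y => y + -v j) ⁻¹' S) := fun j _ =>
    measurable_add_const _ hS
  have hdis : (↑(Finset.range N) : Set ℕ).PairwiseDisjoint
      (fun j => (fun y => y + -v j) ⁻¹' S) := by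
    intro i hi j hj hij
    rw [Function.onFun, Set.disjoint_left]
    intro y hy hy'
    simp only [Finset.coe_range, mem_Iio] at hi hj
    rcases lt_or_gt_of_ne hij with h | h
    · exact hd i hi j hj h _ hy _ hy' (by simp)
    · exact hd j hj i hi h _ hy' _ hy (by simp)
  calc (N : ℝ≥0∞) * μ S = ∑ j ∈ Finset.range N, μ ((fun y => y + -v j) ⁻¹' S) := by
        simp [measure_preimage_add_right]
    _ = μ (⋃ j ∈ Finset.range N, (fun y => y + -v j) ⁻¹' S) :=
        (measure_biUnion_finset hdis hm).symm
    _ ≤ μ B := by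
        refine measure_mono (iUnion₂_subset fun j hj y hy => ?_)
        simpa using hB _ hy j (Finset.mem_range.1 hj)

section
variable {d : ℕ} {π q : EuclideanSpace ℝ (Fin d) → ℝ}

namespace IsSuperExpRegular

theorem hasGradientAt_log (h : IsSuperExpRegular π) (x : EuclideanSpace ℝ (Fin d)) :
    HasGradientAt (fun y => Real.log (π y)) (gradient (fun y => Real.log (π y)) x) x :=
  ((h.contDiff.differentiable (by simp) x).log (h.pos x).ne').hasGradientAt

theorem gradient_log (h : IsSuperExpRegular π) (x : EuclideanSpace ℝ (Fin d)) :
    gradient (fun y => Real.log (π y)) x = (π x)⁻¹ • gradient π x := by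
  refine HasGradientAt.gradient ?_
  have h1 := (h.contDiff.differentiable (by simp) x).hasGradientAt
  rw [hasGradientAt_iff_hasFDerivAt] at h1 ⊢
  simpa using h1.log (h.pos x).ne'

/-- The gradients of `log π` and `π` are parallel, so regular contours bound the angle with `x`;
Cauchy–Schwarz and the super-exponential tail make the norm diverge. -/
theorem exists_inner_gradient_log_le (h : IsSuperExpRegular π) :
    ∃ c > 0, c ≤ 1 ∧ ∀ L : ℝ, ∃ R > 0, ∀ x : EuclideanSpace ℝ (Fin d), R ≤ ‖x‖ →
      inner ℝ (‖x‖⁻¹ • x) (gradient (fun y => Real.log (π y)) x) ≤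
        -(c * ‖gradient (fun y => Real.log (π y)) x‖) ∧
      L ≤ ‖gradient (fun y => Real.log (π y)) x‖ := by
  obtain ⟨a, ha, ha0⟩ := exists_between h.regularContours
  have hev := eventually_lt_of_limsup_lt ha (by
    refine isBoundedUnder_of ⟨1, fun x => ?_⟩
    refine (real_inner_le_norm _ _).trans ?_
    rw [norm_smul, norm_smul, norm_inv, norm_inv, norm_norm, norm_norm]
    exact mul_le_one₀ inv_mul_le_one (by positivity) inv_mul_le_one)
  refine ⟨min 1 (-a), lt_min one_pos (by linarith), min_le_left _ _, fun L => ?_⟩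
  have hev2 := h.superExp.eventually_le_atBot (-L)
  obtain ⟨R, hR⟩ := (Metric.hasBasis_cobounded_compl_closedBall
    (0 : EuclideanSpace ℝ (Fin d))).eventually_iff.1 (hev.and hev2)
  refine ⟨max 1 (R + 1), by positivity, fun x hx => ?_⟩
  have hxR : x ∈ (Metric.closedBall (0 : EuclideanSpace ℝ (Fin d)) R)ᶜ := by
    have := (le_max_right _ _).trans hx
    simp only [mem_compl_iff, Metric.mem_closedBall, dist_zero_right, not_le]
    linarith
  obtain ⟨h1, h2⟩ := hR.2 hxR
  have hx0 : ‖‖x‖⁻¹ • x‖ ≤ 1 := by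
    rw [norm_smul, norm_inv, norm_norm]; exact inv_mul_le_one
  constructor
  · rw [h.gradient_log, inner_smul_right, norm_smul, Real.norm_of_nonneg (by have := h.pos x; positivity)]
    rw [inner_smul_right] at h1
    -- A vanishing gradient would have normalised inner product `0`, which is not below `a < 0`.
    have hg : 0 < ‖gradient π x‖ := by
      rcases (norm_nonneg (gradient π x)).eq_or_lt with h0 | h0
      · rw [← h0] at h1; simp at h1; linarith
      · exact h0
    have h3 : inner ℝ (‖x‖⁻¹ • x) (gradient π x) < a * ‖gradient π x‖ := by
      rwa [inv_mul_lt_iff₀ hg, mul_comm] at h1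
    have h4 := h.pos x
    have h5 : min 1 (-a) * ‖gradient π x‖ ≤ (-a) * ‖gradient π x‖ := by
      gcongr; exact min_le_right _ _
    calc _ ≤ (π x)⁻¹ * (-(min 1 (-a) * ‖gradient π x‖)) := by gcongr; linarith
      _ = _ := by ring
  · have h3 := (abs_le.1 (abs_real_inner_le_norm (‖x‖⁻¹ • x)
      (gradient (fun y => Real.log (π y)) x))).1
    have h4 : ‖‖x‖⁻¹ • x‖ * ‖gradient (fun y => Real.log (π y)) x‖ ≤
      1 * ‖gradient (fun y => Real.log (π y)) x‖ := by gcongr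
    linarith

/-- Directions close to `-x / |x|` are steep ascent directions throughout a fixed ball around a
distant `x`. Tilting `v` and replacing `x / |x|` by `y / |y|` cost `c / 4` each, leaving slope `c /
2 * ‖g‖`. -/
theorem exists_le_inner_gradient_log (h : IsSuperExpRegular π) :
    ∃ c > 0, c < 1 ∧ ∀ L r : ℝ, 0 < r → ∃ R > 0, ∀ x : EuclideanSpace ℝ (Fin d), R ≤ ‖x‖ →
      ∀ y, ‖y - x‖ ≤ r → ∀ v, ‖v + ‖x‖⁻¹ • x‖ ≤ c →
        L ≤ inner ℝ (gradient (fun y => Real.log (π y)) y) v := by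
  obtain ⟨c, hc, hc1, H⟩ := h.exists_inner_gradient_log_le
  refine ⟨c / 4, by positivity, by linarith, fun L r hr => ?_⟩
  obtain ⟨R, hR, H⟩ := H (max 0 (2 * L / c))
  refine ⟨R + r + 8 * r / c, by positivity, fun x hx y hy v hv => ?_⟩
  have h8 : 0 < 8 * r / c := by positivity
  have hyR : R ≤ ‖y‖ := by
    have := norm_sub_norm_le x y
    rw [norm_sub_rev] at this
    linarith
  obtain ⟨h1, h2⟩ := H y hyR
  set g := gradient (fun y => Real.log (π y)) y
  have hx0 : 0 < ‖x‖ := by linarith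
  have hy0 : 0 < ‖y‖ := by linarith
  have hn := norm_inv_smul_sub_inv_smul_le (norm_pos_iff.1 hx0) (norm_pos_iff.1 hy0)
  have hn2 : ‖‖x‖⁻¹ • x - ‖y‖⁻¹ • y‖ ≤ c / 4 := by
    refine hn.trans ?_
    rw [div_le_iff₀ hx0]
    have : 8 * r / c ≤ ‖x‖ := by linarith
    rw [div_le_iff₀ hc] at this
    linarith
  have hdec : v = -(‖y‖⁻¹ • y) + ((v + ‖x‖⁻¹ • x) - (‖x‖⁻¹ • x - ‖y‖⁻¹ • y)) := by abel
  have h3 : -(‖g‖ * (c / 4 + c / 4)) ≤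
      inner ℝ g ((v + ‖x‖⁻¹ • x) - (‖x‖⁻¹ • x - ‖y‖⁻¹ • y)) := by
    have h4 := (abs_le.1 (abs_real_inner_le_norm g
      ((v + ‖x‖⁻¹ • x) - (‖x‖⁻¹ • x - ‖y‖⁻¹ • y)))).1
    have h5 : ‖g‖ * ‖(v + ‖x‖⁻¹ • x) - (‖x‖⁻¹ • x - ‖y‖⁻¹ • y)‖ ≤ ‖g‖ * (c / 4 + c / 4) := by
      gcongr
      exact (norm_sub_le _ _).trans (add_le_add hv hn2)
    linarith
  rw [hdec, inner_add_right, inner_neg_right, real_inner_comm]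
  have h6 : 2 * L / c ≤ ‖g‖ := (le_max_right _ _).trans h2
  rw [div_le_iff₀ hc] at h6
  linarith

theorem exists_log_add_le_log (h : IsSuperExpRegular π) :
    ∃ c > 0, c < 1 ∧ ∀ L r : ℝ, 0 < r → ∃ R > 0, ∀ x : EuclideanSpace ℝ (Fin d), R ≤ ‖x‖ →
      ∀ v, ‖v + ‖x‖⁻¹ • x‖ ≤ c → ∀ τ : ℝ, 0 ≤ τ → ∀ z, ‖z - x‖ ≤ r → ‖z + τ • v - x‖ ≤ r →
        Real.log (π z) + L * τ ≤ Real.log (π (z + τ • v)) := by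
  obtain ⟨c, hc, hc1, H⟩ := h.exists_le_inner_gradient_log
  refine ⟨c, hc, hc1, fun L r hr => ?_⟩
  obtain ⟨R, hR, H⟩ := H L r hr
  refine ⟨R, hR, fun x hx v hv τ hτ z hz hz' => ?_⟩
  have hder : ∀ t : ℝ, HasDerivAt (fun t : ℝ => Real.log (π (z + t • v)))
      (inner ℝ (gradient (fun y => Real.log (π y)) (z + t • v)) v) t := fun t => by
    have h1 := (h.hasGradientAt_log (z + t • v)).hasFDerivAt
    have h2 : HasDerivAt (fun t : ℝ => z + t • v) v t := by
      simpa using ((hasDerivAt_id t).smul_const v).const_add z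
    have h3 := h1.comp_hasDerivAt t h2
    exact h3
  have hball : ∀ t ∈ Icc 0 τ, ‖z + t • v - x‖ ≤ r := by
    intro t ht
    have hconv := convex_closedBall x r
    have h1 : z ∈ Metric.closedBall x r := by rwa [mem_closedBall_iff_norm]
    have h2 : z + τ • v ∈ Metric.closedBall x r := by rwa [mem_closedBall_iff_norm]
    rcases hτ.eq_or_lt with h0 | h0
    · have : t = 0 := le_antisymm (h0 ▸ ht.2) ht.1
      simpa [this] using hz
    · have h3 := hconv.add_smul_mem h1 h2 (t := t / τ)
        ⟨div_nonneg ht.1 hτ, (div_le_one h0).2 ht.2⟩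
      rwa [smul_smul, div_mul_cancel₀ _ h0.ne', mem_closedBall_iff_norm] at h3
  have := (convex_Icc (0 : ℝ) τ).mul_sub_le_image_sub_of_le_deriv
    (f := fun t : ℝ => Real.log (π (z + t • v))) (C := L)
    (fun t _ => (hder t).continuousAt.continuousWithinAt)
    (fun t _ => (hder t).differentiableAt.differentiableWithinAt)
    (fun t ht => by
      rw [(hder t).deriv]
      exact H x hx _ (hball t (interior_subset ht)) v hv)
    0 ⟨le_rfl, hτ⟩ τ ⟨hτ, le_rfl⟩ hτ
  simp only [sub_zero, zero_smul, add_zero] at this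
  linarith

/-- Outside a ball `π` decreases along rays, so its values are dominated by those on the compact
ball. -/
theorem bddAbove_range (h : IsSuperExpRegular π) : BddAbove (range π) := by
  obtain ⟨c, hc, -, H⟩ := h.exists_inner_gradient_log_le
  obtain ⟨R, hR, H⟩ := H 0
  have hcont : Continuous π := h.contDiff.continuous
  obtain ⟨B, hB⟩ := (isCompact_closedBall (0 : EuclideanSpace ℝ (Fin d)) R).bddAbove_image
    hcont.continuousOn
  have hB' : ∀ y, ‖y‖ ≤ R → π y ≤ B := fun y hy => hB ⟨y, by simpa using hy, rfl⟩
  refine ⟨B, ?_⟩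
  rintro _ ⟨x, rfl⟩
  rcases le_total ‖x‖ R with hx | hx
  · exact hB' x hx
  have hx0 : 0 < ‖x‖ := hR.trans_le hx
  have hder : ∀ t : ℝ, HasDerivAt (fun t : ℝ => Real.log (π (t • x)))
      (inner ℝ (gradient (fun y => Real.log (π y)) (t • x)) x) t := fun t => by
    have h1 := (h.hasGradientAt_log (t • x)).hasFDerivAt
    have h2 : HasDerivAt (fun t : ℝ => t • x) x t := by
      simpa using (hasDerivAt_id t).smul_const x
    have h3 := h1.comp_hasDerivAt t h2
    exact h3
  have hle : R / ‖x‖ ≤ 1 := (div_le_one hx0).2 hx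
  have := (convex_Icc (R / ‖x‖) 1).image_sub_le_mul_sub_of_deriv_le
    (f := fun t : ℝ => Real.log (π (t • x))) (C := 0)
    (fun t _ => (hder t).continuousAt.continuousWithinAt)
    (fun t _ => (hder t).differentiableAt.differentiableWithinAt)
    (fun t ht => by
      have ht' := interior_subset ht
      have ht0 : 0 < t := lt_of_lt_of_le (by positivity) ht'.1
      have hn : ‖t • x‖ = t * ‖x‖ := by rw [norm_smul, Real.norm_of_nonneg ht0.le]
      obtain ⟨h1, -⟩ := H (t • x) (by rw [hn, ← div_le_iff₀ hx0]; exact ht'.1)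
      rw [(hder t).deriv, real_inner_comm]
      have h2 : x = ‖x‖ • (‖t • x‖⁻¹ • (t • x)) := by
        rw [smul_smul, smul_smul, hn]
        have : ‖x‖ * ((t * ‖x‖)⁻¹ * t) = 1 := by field_simp
        rw [← mul_assoc] at this
        rw [this, one_smul]
      rw [h2, inner_smul_left, ← h2]
      simp only [conj_trivial]
      have h3 : 0 ≤ c * ‖gradient (fun y => Real.log (π y)) (t • x)‖ := by positivity
      exact mul_nonpos_of_nonneg_of_nonpos hx0.le (by linarith))
    (R / ‖x‖) ⟨le_rfl, hle⟩ 1 ⟨hle, le_rfl⟩ hle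
  simp only [one_smul, zero_mul, sub_nonpos] at this
  refine ((Real.log_le_log_iff (h.pos _) (h.pos _)).1 this).trans (hB' _ ?_)
  rw [norm_smul, Real.norm_of_nonneg (by positivity), div_mul_cancel₀ _ hx0.ne']

theorem le_iSup (h : IsSuperExpRegular π) (x : EuclideanSpace ℝ (Fin d)) : π x ≤ ⨆ z, π z :=
  le_ciSup h.bddAbove_range x

theorem exists_pos_le_on_closedBall (h : IsSuperExpRegular π) (R : ℝ) :
    ∃ m > 0, ∀ x, ‖x‖ ≤ R → m ≤ π x := by
  rcases (Metric.closedBall (0 : EuclideanSpace ℝ (Fin d)) R).eq_empty_or_nonempty with h0 | h0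
  · refine ⟨1, one_pos, fun x hx => ?_⟩
    have : x ∈ Metric.closedBall (0 : EuclideanSpace ℝ (Fin d)) R := by simpa using hx
    simp [h0] at this
  · obtain ⟨z, -, hz⟩ := (isCompact_closedBall (0 : EuclideanSpace ℝ (Fin d)) R).exists_isMinOn h0
      h.contDiff.continuous.continuousOn
    exact ⟨π z, h.pos z, fun x hx => hz (by simpa using hx)⟩

end IsSuperExpRegular
end

/-! ### Proposal probabilities of regions of the density ratio. -/

section
variable {d : ℕ} {π q : EuclideanSpace ℝ (Fin d) → ℝ}

namespace IsIncrementDensity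

theorem rwProposal_apply (hq : IsIncrementDensity q) (x : EuclideanSpace ℝ (Fin d)) :
    rwProposal q x = volume.withDensity (fun y => ENNReal.ofReal (q (y - x))) := by
  have hm := hq.measurable
  rw [rwProposal, Kernel.withDensity_apply _ (by unfold Function.uncurry; fun_prop),
    Kernel.const_apply]

theorem rwProposal_apply_apply (hq : IsIncrementDensity q) (x : EuclideanSpace ℝ (Fin d))
    {s : Set (EuclideanSpace ℝ (Fin d))} (hs : MeasurableSet s) :
    rwProposal q x s = ∫⁻ z in (fun z => z + x) ⁻¹' s, ENNReal.ofReal (q z) := by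
  rw [hq.rwProposal_apply, withDensity_apply _ hs, ← lintegral_indicator hs,
    ← lintegral_indicator (measurable_add_const x hs),
    ← lintegral_add_right_eq_self _ x]
  congr 1 with z
  by_cases hz : z + x ∈ s
  · rw [indicator_of_mem hz, indicator_of_mem (by exact hz), add_sub_cancel_right]
  · rw [indicator_of_notMem hz, indicator_of_notMem (by exact hz)]

theorem isMarkovKernel_rwProposal (hq : IsIncrementDensity q) :
    IsMarkovKernel (rwProposal q) :=
  ⟨fun x => ⟨by rw [hq.rwProposal_apply_apply x MeasurableSet.univ]; simpa using hq.lintegral_eq_one⟩⟩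

theorem rwProposal_absolutelyContinuous (hq : IsIncrementDensity q)
    (x : EuclideanSpace ℝ (Fin d)) : rwProposal q x ≪ volume := by
  rw [hq.rwProposal_apply]; exact withDensity_absolutelyContinuous _ _

theorem exists_ball (hq : IsIncrementDensity q) :
    ∃ ε > 0, ∃ r > 0, ∀ z, ‖z‖ < r → ε ≤ q z := by
  obtain ⟨ε, hε, h⟩ := hq.bounded_below
  obtain ⟨r, hr, h⟩ := Metric.eventually_nhds_iff.1 h
  exact ⟨ε, hε, r, hr, fun z hz => h (by simpa using hz)⟩

/-- The proposal puts at least mass `ε vol(B(0, ρ))` on balls of radius `ρ` contained in the region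
where the increment density is at least `ε`. -/
theorem le_real_rwProposal (hq : IsIncrementDensity q) {ε r ρ : ℝ} (hε : 0 ≤ ε)
    (h : ∀ z, ‖z‖ < r → ε ≤ q z) (x a : EuclideanSpace ℝ (Fin d)) (ha : ‖a - x‖ + ρ ≤ r)
    {s : Set (EuclideanSpace ℝ (Fin d))} (hs : Metric.ball a ρ ⊆ s) :
    ε * volume.real (Metric.ball (0 : EuclideanSpace ℝ (Fin d)) ρ) ≤ (rwProposal q x).real s := by
  have := hq.isMarkovKernel_rwProposal
  refine le_trans ?_ (measureReal_mono hs)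
  rw [← ENNReal.toReal_ofReal hε, Measure.real, Measure.real, ← ENNReal.toReal_mul]
  refine ENNReal.toReal_mono (measure_ne_top _ _) ?_
  rw [hq.rwProposal_apply, withDensity_apply _ Metric.isOpen_ball.measurableSet,
    ← Measure.addHaar_ball_center volume a, ← setLIntegral_const]
  refine setLIntegral_mono_ae (by have := hq.measurable; fun_prop) (ae_of_all _ fun y hy => ?_)
  refine ENNReal.ofReal_le_ofReal (h _ ?_)
  rw [mem_ball_iff_norm] at hy
  have : ‖y - x‖ ≤ ‖y - a‖ + ‖a - x‖ := norm_sub_le_norm_sub_add_norm_sub _ _ _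
  linarith

theorem exists_rwProposal_compl_closedBall_le (hq : IsIncrementDensity q) {ε : ℝ≥0∞}
    (hε : 0 < ε) : ∃ r > 0, ∫⁻ z in (Metric.closedBall (0 : EuclideanSpace ℝ (Fin d)) r)ᶜ,
      ENNReal.ofReal (q z) ≤ ε := by
  have : IsFiniteMeasure ((volume : Measure (EuclideanSpace ℝ (Fin d))).withDensity
      (fun z => ENNReal.ofReal (q z))) :=
    ⟨by rw [withDensity_apply _ MeasurableSet.univ, setLIntegral_univ, hq.lintegral_eq_one]; simp⟩
  set μ := (volume : Measure (EuclideanSpace ℝ (Fin d))).withDensity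
      (fun z => ENNReal.ofReal (q z)) with hμ
  have hanti : Antitone fun n : ℕ => (Metric.closedBall (0 : EuclideanSpace ℝ (Fin d)) n)ᶜ :=
    fun m n hmn => compl_subset_compl.2 (Metric.closedBall_subset_closedBall (by exact_mod_cast hmn))
  have ht := tendsto_measure_iInter_atTop (μ := μ)
    (fun n : ℕ => (Metric.isClosed_closedBall (x := (0 : EuclideanSpace ℝ (Fin d))) (ε := n)
      ).measurableSet.compl.nullMeasurableSet) hanti ⟨0, measure_ne_top _ _⟩
  have h0 : ⋂ n : ℕ, (Metric.closedBall (0 : EuclideanSpace ℝ (Fin d)) n)ᶜ = ∅ := by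
    rw [← compl_iUnion, Metric.iUnion_closedBall_nat, compl_univ]
  rw [h0, measure_empty] at ht
  obtain ⟨n, hn, hn'⟩ := ((ht.eventually (gt_mem_nhds hε)).and (eventually_gt_atTop 0)).exists
  refine ⟨n, by exact_mod_cast hn', ?_⟩
  rw [Function.comp_apply, hμ, withDensity_apply _ Metric.isClosed_closedBall.measurableSet.compl] at hn
  exact hn.le

end IsIncrementDensity

/-- A ball shifted from `x` towards the origin lies where the increment density is at least `ε`. Its
mass is independent of `K`; only the distance beyond which `π` rises by a factor `K` on it depends
on `K`. -/
theorem exists_le_real_rwProposal_of_large (hπ : IsSuperExpRegular π)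
    (hq : IsIncrementDensity q) :
    ∃ p > 0, ∀ K : ℝ, ∃ R > 0, ∀ x, R ≤ ‖x‖ → p ≤ (rwProposal q x).real {y | K ≤ π y / π x} := by
  obtain ⟨ε, hε, r, hr, hεq⟩ := hq.exists_ball
  obtain ⟨c, hc, hc1, H⟩ := hπ.exists_log_add_le_log
  refine ⟨ε * volume.real (Metric.ball (0 : EuclideanSpace ℝ (Fin d)) (r / 2 * c)),
    mul_pos hε ?_, fun K => ?_⟩
  · exact ENNReal.toReal_pos (Metric.measure_ball_pos _ _ (by positivity)).ne'
      measure_ball_lt_top.ne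
  obtain ⟨R, hR, H⟩ := H (2 / r * Real.log (max K 1)) r hr
  refine ⟨R, hR, fun x hx => ?_⟩
  have hx0 : 0 < ‖x‖ := hR.trans_le hx
  have hn : ‖‖x‖⁻¹ • x‖ = 1 := by
    rw [norm_smul, norm_inv, norm_norm, inv_mul_cancel₀ hx0.ne']
  refine hq.le_real_rwProposal hε.le hεq x (x - (r / 2) • ‖x‖⁻¹ • x) ?_ fun y hy => ?_
  · rw [sub_sub_cancel_left, norm_neg, norm_smul, hn, Real.norm_of_nonneg (by positivity)]
    nlinarith
  · set v := (2 / r) • (y - x) with hv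
    have hy' : y = x + (r / 2) • v := by
      rw [hv, smul_smul, div_mul_div_comm, mul_comm r 2, div_self (by positivity)]; simp
    have hvn : ‖v + ‖x‖⁻¹ • x‖ ≤ c := by
      rw [mem_ball_iff_norm, hy'] at hy
      have : x + (r / 2) • v - (x - (r / 2) • ‖x‖⁻¹ • x) = (r / 2) • (v + ‖x‖⁻¹ • x) := by
        rw [smul_add]; abel
      rw [this, norm_smul, Real.norm_of_nonneg (by positivity)] at hy
      exact (lt_of_mul_lt_mul_left hy (by positivity)).le
    have hv2 : ‖v‖ ≤ 2 := by
      have : ‖v‖ ≤ ‖v + ‖x‖⁻¹ • x‖ + ‖‖x‖⁻¹ • x‖ := by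
        simpa using norm_sub_le (v + ‖x‖⁻¹ • x) (‖x‖⁻¹ • x)
      linarith
    have := H x hx v hvn (r / 2) (by positivity) x (by simpa using hr.le) (by
      rw [add_sub_cancel_left, norm_smul, Real.norm_of_nonneg (by positivity)]
      nlinarith)
    rw [← hy'] at this
    have h1 : Real.log (max K 1) ≤ Real.log (π y / π x) := by
      rw [Real.log_div (hπ.pos y).ne' (hπ.pos x).ne']
      have h2 : 2 / r * Real.log (max K 1) * (r / 2) = Real.log (max K 1) := by field_simp
      linarith
    rw [Real.log_le_log_iff (by positivity) (div_pos (hπ.pos y) (hπ.pos x))] at h1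
    exact (le_max_left _ _).trans h1

/-- Far out this is the previous lemma with `K = 1`; near the origin `π` is bounded below on a
compact ball and above everywhere. -/
theorem exists_le_real_rwProposal (hπ : IsSuperExpRegular π) (hq : IsIncrementDensity q) :
    ∃ p > 0, ∃ κ > 0, κ ≤ 1 ∧ ∀ x, p ≤ (rwProposal q x).real {y | κ ≤ π y / π x} := by
  have := hq.isMarkovKernel_rwProposal
  obtain ⟨p, hp, H⟩ := exists_le_real_rwProposal_of_large hπ hq
  obtain ⟨R, hR, H⟩ := H 1
  obtain ⟨ε, hε, r, hr, hεq⟩ := hq.exists_ball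
  obtain ⟨m, hm, hmπ⟩ := hπ.exists_pos_le_on_closedBall (R + r)
  have hc : 0 < ⨆ z, π z := (hπ.pos 0).trans_le (hπ.le_iSup 0)
  have hp' : 0 < ε * volume.real (Metric.ball (0 : EuclideanSpace ℝ (Fin d)) r) :=
    mul_pos hε (ENNReal.toReal_pos (Metric.measure_ball_pos _ _ hr).ne' measure_ball_lt_top.ne)
  refine ⟨min p (ε * volume.real (Metric.ball (0 : EuclideanSpace ℝ (Fin d)) r)),
    lt_min hp hp', min 1 (m / ⨆ z, π z), by positivity, min_le_left _ _, fun x => ?_⟩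
  rcases le_total R ‖x‖ with hx | hx
  · refine (min_le_left _ _).trans ((H x hx).trans (measureReal_mono fun y hy => ?_))
    exact le_trans (min_le_left _ _) (mem_ofPred.1 hy)
  · refine (min_le_right _ _).trans (hq.le_real_rwProposal hε.le hεq x x (by simp) fun y hy => ?_)
    rw [mem_ofPred]
    refine le_trans (min_le_right _ _) ?_
    rw [mem_ball_iff_norm] at hy
    have : ‖y‖ ≤ ‖y - x‖ + ‖x‖ := by simpa using norm_add_le (y - x) x
    exact div_le_div₀ (hπ.pos y).le (hmπ y (by linarith)) (hπ.pos x) (hπ.le_iSup x)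

/-- The region of moderate density ratio within a fixed distance of `x` has small volume. -/
theorem exists_volume_ratio_mem_Ioo_le (hπ : IsSuperExpRegular π) {K r : ℝ} (hK : 1 < K)
    (hr : 0 < r) {ε : ℝ≥0∞} (hε : 0 < ε) :
    ∃ R > 0, ∀ x, R ≤ ‖x‖ →
      volume ({y | π y / π x ∈ Ioo K⁻¹ K} ∩ Metric.closedBall x r) ≤ ε := by
  obtain ⟨c, hc, -, H⟩ := hπ.exists_log_add_le_log
  set B := volume (Metric.closedBall (0 : EuclideanSpace ℝ (Fin d)) (r + 1)) with hB
  have hBtop : B ≠ ∞ := measure_closedBall_lt_top.ne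
  obtain ⟨N, hN, hN0⟩ : ∃ N : ℕ, B / N ≤ ε ∧ N ≠ 0 := by
    have : Tendsto (fun n : ℕ => B / n) atTop (𝓝 0) :=
      by simpa using ENNReal.Tendsto.const_div (a := B) ENNReal.tendsto_nat_nhds_top (Or.inr hBtop)
    obtain ⟨N, h1, h2⟩ := ((this.eventually (gt_mem_nhds hε)).and (eventually_gt_atTop 0)).exists
    exact ⟨N, h1.le, h2.ne'⟩
  have hNpos : (0 : ℝ) < N := by positivity
  -- With this slope a shift by `1 / N` raises `log π` by at least `2 * log K`, the length of the
  -- admitted open interval. The `N` translates are therefore disjoint, and they stay in a ball of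
  -- radius `r + 1`.
  obtain ⟨R, hR, H⟩ := H (2 * N * Real.log K) (r + 1) (by positivity)
  refine ⟨R, hR, fun x hx => ?_⟩
  have hx0 : 0 < ‖x‖ := hR.trans_le hx
  have hn : ‖-(‖x‖⁻¹ • x)‖ = 1 := by
    rw [norm_neg, norm_smul, norm_inv, norm_norm, inv_mul_cancel₀ hx0.ne']
  set n := -(‖x‖⁻¹ • x) with hndef
  have hmeas : MeasurableSet ({y | π y / π x ∈ Ioo K⁻¹ K} ∩ Metric.closedBall x r) := by
    refine MeasurableSet.inter ?_ Metric.isClosed_closedBall.measurableSet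
    exact (hπ.contDiff.continuous.measurable.div_const _) measurableSet_Ioo
  have hlog : ∀ y ∈ {y | π y / π x ∈ Ioo K⁻¹ K} ∩ Metric.closedBall x r,
      |Real.log (π y) - Real.log (π x)| < Real.log K := by
    rintro y ⟨hy, -⟩
    have hpos : 0 < π y / π x := div_pos (hπ.pos y) (hπ.pos x)
    rw [← Real.log_div (hπ.pos y).ne' (hπ.pos x).ne', abs_lt, ← Real.log_inv]
    exact ⟨Real.log_lt_log (by positivity) hy.1, Real.log_lt_log hpos hy.2⟩
  have hshift : ∀ j : ℕ, j < N → ‖((j : ℝ) / N) • n‖ ≤ 1 := fun j hj => by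
    rw [norm_smul, hn, mul_one, Real.norm_of_nonneg (by positivity), div_le_one hNpos]
    exact_mod_cast hj.le
  have key := nsmul_measure_le_of_disjoint_translates volume hmeas
    (B := Metric.closedBall x (r + 1)) (fun j => ((j : ℝ) / N) • n) N
    (fun i hi j hj hij y hy z hz he => by
      have hy' : y = z + (((j - i : ℕ) : ℝ) / N) • n := by
        rw [Nat.cast_sub hij.le, sub_div, sub_smul]
        have := congrArg (fun w => w - ((i : ℝ) / N) • n) he
        simp only [add_sub_cancel_right] at this
        rw [this]; abel
      have h1 := H x hx n (by rw [hndef]; simpa using hc.le) (((j - i : ℕ) : ℝ) / N)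
        (by positivity) z
        (by have := hz.2; rw [mem_closedBall_iff_norm] at this; linarith)
        (by rw [← hy']; have := hy.2; rw [mem_closedBall_iff_norm] at this; linarith)
      rw [← hy'] at h1
      have h2 := abs_lt.1 (hlog y hy)
      have h3 := abs_lt.1 (hlog z hz)
      have h4 : 2 * N * Real.log K * (((j - i : ℕ) : ℝ) / N) = 2 * Real.log K * (j - i : ℕ) := by
        field_simp
      have h5 : (1 : ℝ) ≤ (j - i : ℕ) := by exact_mod_cast Nat.sub_pos_of_lt hij
      have h6 : 0 < Real.log K := Real.log_pos hK
      nlinarith)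
    (fun y hy j hj => by
      have := hy.2
      rw [mem_closedBall_iff_norm] at this ⊢
      rw [add_sub_right_comm]
      exact (norm_add_le _ _).trans (add_le_add this (hshift j hj)))
  rw [Measure.addHaar_closedBall_center, ← hB] at key
  refine le_trans ?_ hN
  rw [ENNReal.le_div_iff_mul_le (Or.inl (by exact_mod_cast hN0)) (Or.inl (by simp)), mul_comm]
  exact key

/-- Since `q` may be unbounded, small volume becomes small mass by absolute continuity of the
integral, after cutting off the tail of `q`. Translating to the origin makes both choices uniform in
`x`. -/
theorem exists_real_rwProposal_ratio_mem_Ioo_le (hπ : IsSuperExpRegular π)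
    (hq : IsIncrementDensity q) {K ε : ℝ} (hK : 1 < K) (hε : 0 < ε) :
    ∃ R > 0, ∀ x, R ≤ ‖x‖ → (rwProposal q x).real {y | π y / π x ∈ Ioo K⁻¹ K} ≤ ε := by
  have hε' : 0 < ENNReal.ofReal (ε / 2) := by simpa using hε
  obtain ⟨r, hr, hrq⟩ := hq.exists_rwProposal_compl_closedBall_le hε'
  obtain ⟨δ, hδ, hδq⟩ := exists_pos_setLIntegral_lt_of_measure_lt
    (μ := (volume : Measure (EuclideanSpace ℝ (Fin d)))) (f := fun z => ENNReal.ofReal (q z))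
    (by rw [hq.lintegral_eq_one]; simp) hε'.ne'
  obtain ⟨δ', hδ', hδδ⟩ := exists_between hδ
  obtain ⟨R, hR, H⟩ := exists_volume_ratio_mem_Ioo_le hπ hK hr hδ'
  refine ⟨R, hR, fun x hx => ENNReal.toReal_le_of_le_ofReal hε.le ?_⟩
  have hm : MeasurableSet {y | π y / π x ∈ Ioo K⁻¹ K} :=
    (hπ.contDiff.continuous.measurable.div_const _) measurableSet_Ioo
  rw [hq.rwProposal_apply_apply x hm]
  have hmb : MeasurableSet (Metric.closedBall (0 : EuclideanSpace ℝ (Fin d)) r) :=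
    Metric.isClosed_closedBall.measurableSet
  rw [← lintegral_inter_add_sdiff _ _ hmb, ← add_halves ε,
    ENNReal.ofReal_add (by positivity) (by positivity)]
  refine add_le_add (hδq _ ?_).le ?_
  · refine lt_of_le_of_lt (le_of_eq ?_) ((H x hx).trans_lt hδδ)
    rw [← measure_preimage_add_right volume x ({y | π y / π x ∈ Ioo K⁻¹ K} ∩ _)]
    congr 1
    ext z
    simp
  · exact (lintegral_mono_set (sdiff_subset_compl _ _)).trans hrq

end

/-! ### Integration against the pseudo-marginal kernel. -/

section
variable {X : Type*} [MeasurableSpace X] {W : Set ℝ}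

theorem jointProposal_apply (q : Kernel X X) (Q : Kernel X W) (s : X × W) :
    jointProposal q Q s = (q ⊗ₖ Kernel.prodMkLeft X Q) s.1 := by
  rw [jointProposal, Kernel.comap_apply]

instance isMarkovKernel_jointProposal (q : Kernel X X) (Q : Kernel X W) [IsMarkovKernel q]
    [IsMarkovKernel Q] : IsMarkovKernel (jointProposal q Q) := by
  unfold jointProposal; infer_instance

theorem measurable_acceptProb {r : X → X → ℝ} (hr : Measurable (Function.uncurry r)) :
    Measurable (Function.uncurry (acceptProb (W := W) r)) := by
  have h : Measurable fun p : (X × W) × (X × W) => r p.1.1 p.2.1 :=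
    hr.comp (by fun_prop : Measurable fun p : (X × W) × (X × W) => (p.1.1, p.2.1))
  unfold Function.uncurry acceptProb
  fun_prop

theorem pseudoMarginalKernel_apply (q : Kernel X X) {r : X → X → ℝ}
    (hr : Measurable (Function.uncurry r)) (Q : Kernel X W) (s : X × W) :
    pseudoMarginalKernel q r Q s = (jointProposal q Q s).withDensity (acceptProb r s) +
      (1 - ∫⁻ t, acceptProb r s t ∂(jointProposal q Q s)) • Measure.dirac s := by
  have hm := measurable_acceptProb (W := W) hr
  have hm' : Measurable fun s => 1 - ∫⁻ t, acceptProb r s t ∂(jointProposal q Q s) :=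
    measurable_const.sub (hm.lintegral_kernel_prod_right)
  rw [pseudoMarginalKernel, add_apply, Kernel.withDensity_apply _ hm,
    Kernel.withDensity_apply _ (by unfold Function.uncurry; exact hm'.comp measurable_fst),
    Kernel.id_apply, withDensity_const]

theorem integral_pseudoMarginalKernel (q : Kernel X X) [IsMarkovKernel q] {r : X → X → ℝ}
    (hr : Measurable (Function.uncurry r)) (Q : Kernel X W) [IsMarkovKernel Q] (s : X × W)
    (hr0 : ∀ t : X × W, 0 ≤ r s.1 t.1 * ((t.2 : ℝ) / (s.2 : ℝ)))
    {f : X × W → ℝ} (hf : Measurable f)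
    (hi : Integrable (fun t => min 1 (r s.1 t.1 * ((t.2 : ℝ) / (s.2 : ℝ))) * f t)
      (jointProposal q Q s)) :
    Integrable f (pseudoMarginalKernel q r Q s) ∧
      Integrable (fun t => min 1 (r s.1 t.1 * ((t.2 : ℝ) / (s.2 : ℝ))) * (f t - f s))
        (jointProposal q Q s) ∧
      ∫ t, f t ∂(pseudoMarginalKernel q r Q s) = f s +
        ∫ t, min 1 (r s.1 t.1 * ((t.2 : ℝ) / (s.2 : ℝ))) * (f t - f s) ∂(jointProposal q Q s) := by
  have hm : Measurable (acceptProb r s) := (measurable_acceptProb (W := W) hr).of_uncurry_left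
  have hlt : ∀ᵐ t ∂(jointProposal q Q s), acceptProb r s t < ∞ :=
    ae_of_all _ fun t => ENNReal.ofReal_lt_top
  have htr : ∀ t, (acceptProb r s t).toReal = min 1 (r s.1 t.1 * ((t.2 : ℝ) / (s.2 : ℝ))) :=
    fun t => ENNReal.toReal_ofReal (le_min zero_le_one (hr0 t))
  have hle : ∀ t, acceptProb r s t ≤ 1 := fun t => by
    rw [acceptProb, ENNReal.ofReal_le_one]; exact min_le_left _ _
  have hint1 : ∫⁻ t, acceptProb r s t ∂(jointProposal q Q s) ≤ 1 :=
    (lintegral_mono hle).trans (by simp)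
  have hA : Integrable (fun t => min 1 (r s.1 t.1 * ((t.2 : ℝ) / (s.2 : ℝ))))
      (jointProposal q Q s) := by
    simp_rw [← htr]
    exact integrable_toReal_of_lintegral_ne_top hm.aemeasurable (hint1.trans_lt (by simp)).ne
  have hI1 : Integrable f ((jointProposal q Q s).withDensity (acceptProb r s)) := by
    rw [integrable_withDensity_iff_integrable_smul' hm hlt]
    simpa [htr] using hi
  have hI2 : Integrable f ((1 - ∫⁻ t, acceptProb r s t ∂(jointProposal q Q s)) •
      Measure.dirac s) := by
    refine Integrable.smul_measure ?_ (ENNReal.sub_ne_top (by simp))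
    exact integrable_dirac' hf.stronglyMeasurable enorm_lt_top
  have hI3 : Integrable (fun t => min 1 (r s.1 t.1 * ((t.2 : ℝ) / (s.2 : ℝ))) * (f t - f s))
        (jointProposal q Q s) := by
    simp_rw [mul_sub]
    exact hi.sub (hA.mul_const _)
  refine ⟨?_, hI3, ?_⟩
  · rw [pseudoMarginalKernel_apply q hr]
    exact hI1.add_measure hI2
  · rw [pseudoMarginalKernel_apply q hr, integral_add_measure hI1 hI2,
      integral_withDensity_eq_integral_toReal_smul hm hlt, integral_smul_measure,
      integral_dirac' _ _ hf.stronglyMeasurable, ENNReal.toReal_sub_of_le hint1 (by simp),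
      ← integral_toReal hm.aemeasurable hlt]
    simp_rw [htr, smul_eq_mul, mul_sub, ENNReal.toReal_one]
    rw [integral_sub hi (hA.mul_const _), integral_mul_const]
    ring

end

/-! ### From pointwise increments to the drift of `V`. -/

section
variable {d : ℕ} {π q : EuclideanSpace ℝ (Fin d) → ℝ} {W : Set ℝ} {η α β : ℝ}

theorem measurable_driftFun (hπ : Measurable π) :
    Measurable (driftFun (W := W) π η α β) := by
  unfold driftFun
  fun_prop

theorem driftFun_eq_mul (hπ : IsSuperExpRegular π) (hW : W ⊆ Ioi 0)
    (s t : EuclideanSpace ℝ (Fin d) × W) :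
    driftFun π η α β t = driftFun π η α β s * ((π t.1 / π s.1) ^ (-η) *
      max ((t.2 : ℝ) ^ (-α)) ((t.2 : ℝ) ^ β) / max ((s.2 : ℝ) ^ (-α)) ((s.2 : ℝ) ^ β)) := by
  have h1 := hπ.pos s.1
  have h3 : 0 < (s.2 : ℝ) := hW s.2.2
  have h2 : 0 < max ((s.2 : ℝ) ^ (-α)) ((s.2 : ℝ) ^ β) := lt_max_of_lt_left (by positivity)
  rw [driftFun, driftFun, Real.div_rpow (hπ.pos _).le h1.le]
  have : 0 < π s.1 ^ (-η) := by positivity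
  field_simp

theorem max_rpow_le_driftFun (hπ : IsSuperExpRegular π) (hη : 0 ≤ η)
    {s : EuclideanSpace ℝ (Fin d) × W} (h : 0 < (s.2 : ℝ)) :
    max ((s.2 : ℝ) ^ (-α)) ((s.2 : ℝ) ^ β) ≤ driftFun π η α β s := by
  have h1 := hπ.pos s.1
  have h2 : 0 < max ((s.2 : ℝ) ^ (-α)) ((s.2 : ℝ) ^ β) := lt_max_of_lt_left (by positivity)
  have h3 : π s.1 ^ η ≤ (⨆ z, π z) ^ η := Real.rpow_le_rpow h1.le (hπ.le_iSup _) hη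
  have h4 : 1 ≤ (⨆ z, π z) ^ η * π s.1 ^ (-η) := by
    rw [Real.rpow_neg h1.le, ← div_eq_mul_inv, one_le_div (by positivity)]; exact h3
  exact le_mul_of_one_le_left h2.le h4

theorem driftFun_pos (hπ : IsSuperExpRegular π) {s : EuclideanSpace ℝ (Fin d) × W}
    (h : 0 < (s.2 : ℝ)) : 0 < driftFun π η α β s := by
  have h1 := hπ.pos s.1
  have h2 : 0 < max ((s.2 : ℝ) ^ (-α)) ((s.2 : ℝ) ^ β) := lt_max_of_lt_left (by positivity)
  have h3 : 0 < ⨆ z, π z := h1.trans_le (hπ.le_iSup _)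
  unfold driftFun
  positivity

theorem ae_lintegral_le_of_weightMoment_le {Q : Kernel (EuclideanSpace ℝ (Fin d)) W} {a b : ℝ}
    {M : ℝ≥0} (h : weightMoment Q a b ≤ M) :
    ∀ᵐ x, ∫⁻ w, ENNReal.ofReal (max ((w : ℝ) ^ (-a)) ((w : ℝ) ^ b)) ∂(Q x) ≤ M := by
  filter_upwards [ENNReal.ae_le_essSup
    (fun x => ∫⁻ w, ENNReal.ofReal (max ((w : ℝ) ^ (-a)) ((w : ℝ) ^ b)) ∂(Q x))] with x hx
  exact hx.trans h

/-- A drift bound for the pseudo-marginal kernel from a bound on the drift increment, given in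
terms of a region `N` which is unlikely to be proposed and a region `G` where the drift is
negative. -/
theorem integral_driftFun_le (hπ : IsSuperExpRegular π) (hq : IsIncrementDensity q)
    {α' β' : ℝ} {MW : ℝ≥0} (hη : 0 ≤ η) (hη1 : η ≤ 1) (hα : 0 ≤ α) (hαα : α ≤ α')
    (hβ : 0 ≤ β) (hβη : η + β ≤ β') (hW : W ⊆ Ioi 0)
    (Q : Kernel (EuclideanSpace ℝ (Fin d)) W) [IsMarkovKernel Q]
    (hM : weightMoment Q α' β' ≤ MW) (s : EuclideanSpace ℝ (Fin d) × W)
    {N G : Set (EuclideanSpace ℝ (Fin d))} (hN : MeasurableSet N) (hG : MeasurableSet G)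
    {e₁ e₂ c ε p : ℝ} (he₂ : 0 ≤ e₂) (hc : 0 ≤ c)
    (hNε : (rwProposal q s.1).real N ≤ ε) (hGp : p ≤ (rwProposal q s.1).real G)
    (H : ∀ y, DriftIncrementBound η α β α' β' MW s.2 (π y / π s.1)
      (e₁ + N.indicator (fun _ => e₂) y - G.indicator (fun _ => c) y)) :
    Integrable (driftFun π η α β) (pseudoMarginalRWM π q Q s) ∧
      ∫ t, driftFun π η α β t ∂(pseudoMarginalRWM π q Q s) ≤
        driftFun π η α β s * (1 + (e₁ + e₂ * ε - c * p)) := by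
  have := hq.isMarkovKernel_rwProposal
  have hπm : Measurable π := hπ.contDiff.continuous.measurable
  have hVm : Measurable (driftFun (W := W) π η α β) := measurable_driftFun hπm
  have hw : ∀ w : W, 0 < (w : ℝ) := fun w => hW w.2
  have hVpos : 0 < driftFun π η α β s := driftFun_pos hπ (hw _)
  set x := s.1 with hx
  set Hf : W → ℝ := fun u => max ((u : ℝ) ^ (-α')) ((u : ℝ) ^ β') with hHf
  have hHm : Measurable Hf := by rw [hHf]; fun_prop
  have hH0 : ∀ u, 0 ≤ Hf u := fun u => le_max_of_le_left (Real.rpow_nonneg (hw u).le _)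
  -- The moment bound holds only for Lebesgue-almost every `y`, which suffices since the proposal
  -- has a density.
  have hae : ∀ᵐ y ∂(rwProposal q x), ∫⁻ u, ENNReal.ofReal (Hf u) ∂(Q y) ≤ MW :=
    (hq.rwProposal_absolutelyContinuous x).ae_le (ae_lintegral_le_of_weightMoment_le hM)
  have hHJ : Integrable (fun t => Hf t.2) (jointProposal (rwProposal q) Q s) := by
    refine ⟨(hHm.comp measurable_snd).aestronglyMeasurable, ?_⟩
    rw [hasFiniteIntegral_iff_ofReal (ae_of_all _ fun t => hH0 _), jointProposal_apply,
      Kernel.lintegral_compProd _ _ _ (by fun_prop)]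
    refine (lintegral_mono_ae (g := fun _ => (MW : ℝ≥0∞)) ?_).trans_lt (by simp)
    filter_upwards [hae] with y hy
    simpa using hy
  have hrm : Measurable (Function.uncurry fun x y => π y / π x) := by
    unfold Function.uncurry; fun_prop
  have hacc0 : ∀ t : EuclideanSpace ℝ (Fin d) × W,
      0 ≤ π t.1 / π s.1 * ((t.2 : ℝ) / (s.2 : ℝ)) := fun t =>
    mul_nonneg (div_pos (hπ.pos _) (hπ.pos _)).le (div_pos (hw _) (hw _)).le
  -- With `g = η` the density ratio cancels, so a constant multiple of `Hf` dominates.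
  have hiV : Integrable (fun t : EuclideanSpace ℝ (Fin d) × W =>
      min 1 (π t.1 / π s.1 * ((t.2 : ℝ) / (s.2 : ℝ))) * driftFun π η α β t)
      (jointProposal (rwProposal q) Q s) := by
    refine (hHJ.const_mul (driftFun π η α β s * ((s.2 : ℝ) ^ (-η) /
      max ((s.2 : ℝ) ^ (-α)) ((s.2 : ℝ) ^ β)))).mono' ?_ (ae_of_all _ fun t => ?_)
    · exact (Measurable.mul (by fun_prop) hVm).aestronglyMeasurable
    · have h1 := min_mul_rpow_mul_max_le (η := η) (α := α) (β := β) (α' := α') (β' := β') (g := η)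
        (div_pos (hπ.pos t.1) (hπ.pos s.1)) (hw t.2) (hw s.2) hη hη1 hβ hα hαα hβη
      rw [driftFun_eq_mul hπ hW s t, Real.norm_of_nonneg]
      · simp only [sub_self, Real.rpow_zero, one_mul] at h1
        calc _ = driftFun π η α β s * (min 1 (π t.1 / π s.1 * ((t.2 : ℝ) / (s.2 : ℝ))) *
              ((π t.1 / π s.1) ^ (-η) * max ((t.2 : ℝ) ^ (-α)) ((t.2 : ℝ) ^ β) /
                max ((s.2 : ℝ) ^ (-α)) ((s.2 : ℝ) ^ β))) := by ring
          _ ≤ _ := by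
              rw [mul_assoc]
              exact mul_le_mul_of_nonneg_left h1 hVpos.le
      · refine mul_nonneg (le_min zero_le_one (hacc0 t)) ?_
        rw [← driftFun_eq_mul hπ hW s t]
        exact (driftFun_pos hπ (hw _)).le
  obtain ⟨hI, hI2, hE⟩ := integral_pseudoMarginalKernel (rwProposal q) hrm Q s hacc0 hVm hiV
  refine ⟨hI, ?_⟩
  rw [pseudoMarginalRWM, hE]
  have hF : ∀ t : EuclideanSpace ℝ (Fin d) × W,
      min 1 (π t.1 / π s.1 * ((t.2 : ℝ) / (s.2 : ℝ))) *
        (driftFun π η α β t - driftFun π η α β s) =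
      driftFun π η α β s * driftIncrement η α β s.2 (π t.1 / π x) t.2 := fun t => by
    rw [driftFun_eq_mul hπ hW s t, driftIncrement]; ring
  simp_rw [hF] at hI2 ⊢
  have hI3 : Integrable (fun t : EuclideanSpace ℝ (Fin d) × W =>
      driftIncrement η α β s.2 (π t.1 / π x) t.2) (jointProposal (rwProposal q) Q s) := by
    simpa [hVpos.ne'] using hI2.const_mul (driftFun π η α β s)⁻¹
  rw [integral_const_mul, mul_add, mul_one]
  gcongr
  rw [jointProposal_apply] at hI3 ⊢
  rw [integral_compProd hI3]
  have hik : Integrable (fun y => e₁ + N.indicator (fun _ => e₂) y - G.indicator (fun _ => c) y)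
      (rwProposal q x) :=
    ((integrable_const _).add ((integrable_const _).indicator hN)).sub
      ((integrable_const _).indicator hG)
  calc _ ≤ ∫ y, (e₁ + N.indicator (fun _ => e₂) y - G.indicator (fun _ => c) y)
        ∂(rwProposal q x) := by
        refine integral_mono_ae hI3.integral_compProd hik ?_
        filter_upwards [hae, hI3.ae_of_compProd] with y hy hiy
        obtain ⟨c₁, c₂, hc₂, hle, hb⟩ := H y
        refine le_trans ?_ hle
        rw [Kernel.prodMkLeft_apply] at hiy ⊢
        have hHy : Integrable Hf (Q y) := ⟨hHm.aestronglyMeasurable, by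
          rw [hasFiniteIntegral_iff_ofReal (ae_of_all _ fun t => hH0 _)]
          exact hy.trans_lt (by simp)⟩
        have hHle : ∫ u, Hf u ∂(Q y) ≤ MW := by
          rw [integral_eq_lintegral_of_nonneg_ae (ae_of_all _ fun t => hH0 _)
            hHm.aestronglyMeasurable]
          exact ENNReal.toReal_le_coe_of_le_coe hy
        calc _ ≤ ∫ u, (c₁ + c₂ * Hf u) ∂(Q y) :=
              integral_mono hiy ((integrable_const _).add (hHy.const_mul _)) fun u => hb u (hw u)
          _ = c₁ + c₂ * ∫ u, Hf u ∂(Q y) := by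
              rw [integral_add (integrable_const _) (hHy.const_mul _), integral_const_mul]
              simp
          _ ≤ _ := by gcongr
    _ = e₁ + e₂ * (rwProposal q x).real N - c * (rwProposal q x).real G := by
        rw [integral_sub ((integrable_const _).add ((integrable_const _).indicator hN))
          ((integrable_const _).indicator hG), integral_add (integrable_const _)
          ((integrable_const _).indicator hN), integral_indicator_const _ hN,
          integral_indicator_const _ hG]
        simp [mul_comm]
    _ ≤ e₁ + e₂ * ε - c * p := by gcongr

end

/-! ### Polynomial rate and choice of constants. -/

theorem rpow_sub_one_div_le_self {v b : ℝ} (hv : 1 ≤ v) (hb : 0 < b) : v ^ ((b - 1) / b) ≤ v := by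
  conv_rhs => rw [← Real.rpow_one v]
  refine Real.rpow_le_rpow_of_exponent_le hv ?_
  rw [div_le_one hb]; linarith

/-- The source of the exponent: `w ≤ v ^ (1 / b)`, so a relative decrease of order `1 / w` is at
least of order `v ^ (-1 / b)`. -/
theorem rpow_sub_one_div_le_div {v w b : ℝ} (hw : 0 < w) (hv : w ^ b ≤ v) (hb : 0 < b) :
    v ^ ((b - 1) / b) ≤ v / w := by
  have hv0 : 0 < v := lt_of_lt_of_le (by positivity) hv
  have h1 : (b - 1) / b = 1 + -(1 / b) := by field_simp; ring
  rw [h1, Real.rpow_add hv0, Real.rpow_one, Real.rpow_neg hv0.le, div_eq_mul_inv v w]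
  gcongr
  calc w = (w ^ b) ^ (1 / b) := by rw [← Real.rpow_mul hw.le, mul_one_div_cancel hb.ne', Real.rpow_one]
    _ ≤ _ := by gcongr

theorem mainTheorem5 {d : ℕ} (hd : 0 < d) (π q : EuclideanSpace ℝ (Fin d) → ℝ)
    (hπ : IsSuperExpRegular π) (hq : IsIncrementDensity q)
    (α' β' : ℝ) (hα' : 0 < α') (hβ' : 1 < β') (MW : ℝ≥0)
    (η α β : ℝ) (hη : η ∈ Ioo 0 (min α' 1)) (hα : α ∈ Ioc η α') (hβ : β ∈ Ioo 0 (β' - η)) :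
    ∃ w₁ M b w₀ δ : ℝ, 1 ≤ w₁ ∧ 1 ≤ M ∧ 1 ≤ b ∧ 0 < w₀ ∧ w₀ ≤ 1 ∧ 0 < δ ∧
      ∀ (W : Set ℝ), MeasurableSet W → W ⊆ Ioi 0 →
      ∀ (Q : Kernel (EuclideanSpace ℝ (Fin d)) W), IsMarkovKernel Q →
        (∀ x, ∫ w, (w : ℝ) ∂(Q x) = 1) →
        weightMoment Q α' β' ≤ MW →
        ∀ s : EuclideanSpace ℝ (Fin d) × W,
          1 ≤ driftFun π η α β s ∧
          Integrable (driftFun π η α β) (pseudoMarginalRWM π q Q s) ∧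
          (s ∉ driftSet d W M w₀ w₁ →
            ∫ t, driftFun π η α β t ∂(pseudoMarginalRWM π q Q s) ≤
              driftFun π η α β s - δ * driftFun π η α β s ^ ((β - 1) / β)) ∧
          (s ∈ driftSet d W M w₀ w₁ →
            ∫ t, driftFun π η α β t ∂(pseudoMarginalRWM π q Q s) ≤ b) := by
  obtain ⟨hη0, hη⟩ := hη
  obtain ⟨hηα', hη1⟩ := lt_min_iff.1 hη
  obtain ⟨hαη, hαα'⟩ := hα
  obtain ⟨hβ0, hβη⟩ := hβ
  have hα0 : 0 ≤ α := by linarith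
  have hβη' : η + β < β' := by linarith
  obtain ⟨p, hp, κ, hκ, hκ1, hpκ⟩ := exists_le_real_rwProposal hπ hq
  -- Error `κ * p / 4` against gain `κ / 2 * p` leaves `-κ * p / 4`.
  obtain ⟨w₀, hw₀, hw₀1, hsmall⟩ := exists_driftIncrementBound_of_weight_le hκ hκ1
    (by positivity : 0 < κ * p / 4) MW.2 hη0.le hη1.le hβ0.le hαη hαα' hβη'.le
  obtain ⟨w₁, hw₁, δ₁, hδ₁, hlarge⟩ := exists_driftIncrementBound_of_le_weight hκ hκ1
    MW.2 hp hη0.le hη1.le hβ0 hα0 hαα' hα' hβη'.le hβ'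
  obtain ⟨p', hp', hpK⟩ := exists_le_real_rwProposal_of_large hπ hq
  -- `K` depends on `w₀` and `w₁`, and `M` on `K`, whereas `p'` was fixed before `K`. The errors `p'
  -- / 8` here and `p' / 8` from moderate ratios leave half of the gain `p' / 2`.
  obtain ⟨K, hK, hmid⟩ := exists_driftIncrementBound_of_weight_mem_Icc (w₁ := w₁) hw₀ MW.2
    (by positivity : 0 < p' / 8) hη0 hη1 hβ0 hα0 hαα' hα' hβη'
  obtain ⟨R₁, hR₁, hpK⟩ := hpK K
  -- The crude increment bound, used where the ratio is moderate; the `+ 1` makes it positive, hence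
  -- a valid divisor.
  set e₂ : ℝ := w₀ ^ (-η) * MW + 1 with he₂
  have he₂0 : 0 < e₂ := by positivity
  obtain ⟨R₂, hR₂, hNK⟩ := exists_real_rwProposal_ratio_mem_Ioo_le hπ hq hK
    (by positivity : 0 < p' / 8 / e₂)
  set M : ℝ := max 1 (max R₁ R₂) with hM
  obtain ⟨c₀, hc₀, hc₀π⟩ := hπ.exists_pos_le_on_closedBall M
  set B : ℝ := (⨆ z, π z) ^ η * c₀ ^ (-η) * max (w₀ ^ (-α)) (w₁ ^ β) with hB
  have hπm : Measurable π := hπ.contDiff.continuous.measurable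
  refine ⟨w₁, M, max 1 (B * (1 + e₂)), w₀, min (κ * p / 4) (min δ₁ (p' / 4)), hw₁,
    le_max_left _ _, le_max_left _ _, hw₀, hw₀1, by positivity, ?_⟩
  intro W _ hW Q hQ _ hmom s
  have hw : 0 < (s.2 : ℝ) := hW s.2.2
  have hφV := max_rpow_le_driftFun (α := α) (β := β) hπ hη0.le hw
  set V := driftFun π η α β s with hV
  have hV1 : 1 ≤ V := (one_le_max_rpow hw hα0 hβ0.le).trans hφV
  have ha : ∀ y, 0 < π y / π s.1 := fun y => div_pos (hπ.pos y) (hπ.pos s.1)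
  have hratio : ∀ k, MeasurableSet {y | k ≤ π y / π s.1} := fun k =>
    measurableSet_le measurable_const (hπm.div_const _)
  have hVle : V ^ ((β - 1) / β) ≤ V := rpow_sub_one_div_le_self hV1 hβ0
  have hVpow : 0 < V ^ ((β - 1) / β) := by positivity
  -- The relative decrease is `δ' * r`, with `r = 1` for small and moderate weights and `r = 1 / w`
  -- for large ones.
  have hfin : ∀ δ' r, 0 < δ' → min (κ * p / 4) (min δ₁ (p' / 4)) ≤ δ' →
      V ^ ((β - 1) / β) ≤ V * r →
      ∀ I, I ≤ V * (1 + -(δ' * r)) →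
      I ≤ V - min (κ * p / 4) (min δ₁ (p' / 4)) * V ^ ((β - 1) / β) := by
    intro δ' r hδ' hle hr I hI
    have h1 : min (κ * p / 4) (min δ₁ (p' / 4)) * V ^ ((β - 1) / β) ≤ δ' * (V * r) := by gcongr
    linarith
  have hgen {N G : Set (EuclideanSpace ℝ (Fin d))} {e₁ e₂ c ε p : ℝ} :=
    integral_driftFun_le hπ hq (MW := MW) hη0.le hη1.le hα0 hαα' hβ0.le hβη'.le hW Q hmom s
      (N := N) (G := G) (e₁ := e₁) (e₂ := e₂) (c := c) (ε := ε) (p := p)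
  -- With both regions empty this gives integrability at every state and the bound on the set `C`.
  have hcrude := hgen MeasurableSet.empty MeasurableSet.empty le_rfl le_rfl (ε := 0) (p := 0)
    (e₁ := (s.2 : ℝ) ^ (-η) * MW) (by simp) (by simp) fun y => by
      simpa using driftIncrementBound_of_le_weight (ha y) hw le_rfl MW.2 hη0.le hη1.le hβ0.le hα0
        hαα' hβη'.le
  refine ⟨hV1, hcrude.1, fun hs => ?_, fun hs => ?_⟩
  · rcases le_or_gt (s.2 : ℝ) w₀ with h₀ | h₀
    · obtain ⟨h1, h2⟩ := hsmall s.2 hw h₀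
      refine hfin (κ * p / 4) 1 (by positivity) (min_le_left _ _) (by simpa using hVle) _ ?_
      refine (hgen MeasurableSet.empty (hratio κ) le_rfl (by positivity : 0 ≤ κ / 2) (ε := 0)
        (e₁ := κ * p / 4) (by simp) (hpκ s.1) fun y => ?_).2.trans (le_of_eq (by ring))
      by_cases hy : κ ≤ π y / π s.1
      · simpa [indicator, hy] using h2 _ hy
      · simpa [indicator, hy] using h1 _ (ha y)
    rcases le_or_gt w₁ (s.2 : ℝ) with h₁ | h₁
    · obtain ⟨e, c, hc, hec, h1, h2⟩ := hlarge s.2 h₁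
      refine hfin δ₁ (1 / s.2) hδ₁ ((min_le_right _ _).trans (min_le_left _ _)) ?_ _ ?_
      · rw [mul_one_div]
        exact rpow_sub_one_div_le_div hw ((le_max_right _ _).trans hφV) hβ0
      · refine (hgen MeasurableSet.empty (hratio κ) le_rfl hc (ε := 0) (e₁ := e)
          (by simp) (hpκ s.1) fun y => ?_).2.trans ?_
        · by_cases hy : κ ≤ π y / π s.1
          · simpa [indicator, hy] using h2 _ hy
          · simpa [indicator, hy] using h1 _ (ha y)
        · gcongr
          rw [mul_one_div]
          linarith
    · have hsM : M < ‖s.1‖ := by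
        by_contra! h
        exact hs ⟨h, h₀.le, h₁.le⟩
      have hsR₁ : R₁ ≤ ‖s.1‖ := ((le_max_left _ _).trans (le_max_right _ _)).trans hsM.le
      have hsR₂ : R₂ ≤ ‖s.1‖ := ((le_max_right _ _).trans (le_max_right _ _)).trans hsM.le
      obtain ⟨h1, h2⟩ := hmid s.2 ⟨h₀.le, h₁.le⟩
      refine hfin (p' / 4) 1 (by positivity) ((min_le_right _ _).trans (min_le_right _ _))
        (by simpa using hVle) _ ?_
      refine (hgen ((hπm.div_const _) measurableSet_Ioo) (hratio K) he₂0.le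
        (by norm_num : (0 : ℝ) ≤ 1 / 2) (e₁ := p' / 8) (hNK s.1 hsR₂) (hpK s.1 hsR₁)
        fun y => ?_).2.trans (le_of_eq (by rw [mul_div_cancel₀ _ he₂0.ne']; ring))
      rcases le_or_gt K (π y / π s.1) with hy | hy
      · simpa [indicator, hy, not_lt.2 hy] using h2 _ hy
      rcases le_or_gt (π y / π s.1) K⁻¹ with hy' | hy'
      · simpa [indicator, not_le.2 hy, not_lt.2 hy'] using h1 _ (ha y) hy'
      · refine (driftIncrementBound_of_le_weight (ha y) hw₀ h₀.le MW.2 hη0.le hη1.le hβ0.le hα0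
          hαα' hβη'.le).mono ?_
        simp only [indicator, mem_ofPred_eq, mem_preimage, mem_Ioo, hy, hy', not_le.2 hy, and_self,
          if_true, if_false]
        have : (0 : ℝ) < p' / 8 := by positivity
        simp only [NNReal.val_eq_coe]
        linarith
  · obtain ⟨hsM, hs₀, hs₁⟩ := hs
    refine hcrude.2.trans (le_trans ?_ (le_max_right _ _))
    have h3 : (s.2 : ℝ) ^ (-η) ≤ w₀ ^ (-η) := Real.rpow_le_rpow_of_nonpos hw₀ hs₀ (by linarith)
    have h4 : V ≤ B := by
      have hc : 0 < ⨆ z, π z := (hπ.pos 0).trans_le (hπ.le_iSup 0)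
      have h5 : π s.1 ^ (-η) ≤ c₀ ^ (-η) :=
        Real.rpow_le_rpow_of_nonpos hc₀ (hc₀π _ hsM) (by linarith)
      have h6 : (s.2 : ℝ) ^ (-α) ≤ w₀ ^ (-α) :=
        Real.rpow_le_rpow_of_nonpos hw₀ hs₀ (by linarith)
      have h7 : (s.2 : ℝ) ^ β ≤ w₁ ^ β := by gcongr
      rw [hV, hB, driftFun]
      gcongr
    have h8 : (s.2 : ℝ) ^ (-η) * MW ≤ w₀ ^ (-η) * MW := by gcongr
    have h9 : 0 ≤ (s.2 : ℝ) ^ (-η) * MW := by positivity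
    refine mul_le_mul h4 ?_ (by linarith) (by linarith)
    linarith
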